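/- Let $(M_1,g_1)$ be a closed Riemannian manifold, $(S^1,g_2)$ a circle with a Riemannian metric and unit vector field $N$, and let $f$ be a positive smooth function on $M=M_1\times S^1$. Consider on $M$ the foliation $\mathcal F$ by the leaves $M_1\times\{y\}$, with $N$ lifted to $M$ as a field tangent to the circles $\{x\}\times S^1$. A Riemannian metric $g$ on $M$ is called adapted if $g(N,T\mathcal F)=0$ and $g(N,N)=1$; its second fundamental form is $b(X,Y)=g(\nabla_XY,N)$ for $X,Y$ tangent to $\mathcal F$, extended by $b(N,\cdot)=0$, where $\nabla$ is the Levi-Civita connection of $g$. The twisted product $M_1\times_f S^1$ is $M$ with the adapted metric $(f^2g_1)\oplus g_2$. Then there is a family $g_t$ $(t\ge 0)$ of adapted Riemannian metrics, smooth in $(t,x,y)\in[0,\infty)\times M_1\times S^1$, with $$\partial_t g_t=-2\,\mathcal L_N b_t,\qquad g_0=(f^2g_1)\oplus g_2,$$ where $b_t$ is the second fundamental form of $\mathcal F$ with respect to $g_t$ and $\mathcal L_N$ is the Lie derivative. It is unique: any smooth solution through adapted metrics with the same initial metric, defined on an interval $J\subseteq[0,\infty)$ containing $0$, equals $g_t$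 for all $t\in J$. For every $t\ge0$ the metric $g_t$ is a twisted product metric $(f_t^2g_1)\oplus g_2$ with a positive smooth function $f_t$. As $t\to\infty$, the metrics $g_t$ converge uniformly on $M$ (in $C^0$) to the smooth metric of the Riemannian product $(M_1,\bar f\,g_1)\times(S^1,g_2)$, where $$\bar f(x)=\frac{1}{\ell}\int_{S^1}f(x,y)^2\,dy_{g_2},\qquad \ell=\int_{S^1}dy_{g_2}$$ is the mean value of $f(x,\cdot)^2$ with respect to arc length. -/

import Mathlib

open Set Filter Topology Bundle
open scoped Manifold ContDiff

noncomputable section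

namespace ExtrinsicFlow

section General

variable {E : Type*} [NormedAddCommGroup E] [NormedSpace ℝ E]
  {H : Type*} [TopologicalSpace H] (I : ModelWithCorners ℝ E H)
  {M : Type*} [TopologicalSpace M] [ChartedSpace H M] [IsManifold I ∞ M]

variable (M) in
/-- Smooth Riemannian metrics on the manifold `M`. -/
abbrev Metric : Type _ :=
  ContMDiffRiemannianMetric I ∞ E (fun p : M => TangentSpace I p)

/-- A (set-theoretic) vector field on `M`. -/
abbrev VField (M : Type*) [TopologicalSpace M] [ChartedSpace H M] : Type _ :=
  ∀ p : M, TangentSpace I p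

/-- Smoothness of a vector field, as a section of the tangent bundle. -/
def IsSmoothField (X : VField I M) : Prop :=
  ContMDiff I I.tangent ∞ (fun p => (⟨p, X p⟩ : TangentBundle I M))

variable {I}

/-- The function `X(h)`: derivative of the function `h` along the vector field `X`. -/
def dirDeriv (X : VField I M) (h : M → ℝ) : M → ℝ :=
  fun p => mvfderiv I h p (X p)

/-- The function `g(X, Y)`. -/
def Metric.app (g : Metric I M) (X Y : VField I M) : M → ℝ :=
  fun p => g.inner p (X p) (Y p)

/-- The function `g(∇_X Y, Z)`, where `∇` is the Levi-Civita connection of `g`, given by the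
Koszul formula. -/
def leviCivita (g : Metric I M) (X Y Z : VField I M) : M → ℝ :=
  (1 / 2 : ℝ) • (dirDeriv X (g.app Y Z) + dirDeriv Y (g.app X Z) - dirDeriv Z (g.app X Y)
    + g.app (VectorField.mlieBracket I X Y) Z
    - g.app (VectorField.mlieBracket I X Z) Y
    - g.app (VectorField.mlieBracket I Y Z) X)

/-- `g` is adapted to the hyperplane field `D` (the tangent bundle of a codimension-one foliation)
and to the transversal field `N`: `N` is orthogonal to `D` and of length one. -/
def IsAdapted (D : ∀ p : M, Submodule ℝ (TangentSpace I p)) (N : VField I M)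
    (g : Metric I M) : Prop :=
  ∀ p : M, g.inner p (N p) (N p) = 1 ∧ ∀ v ∈ D p, g.inner p (N p) v = 0

/-- The component of `X` orthogonal to the unit field `N`; for a metric adapted to a foliation with
unit normal `N` it is the component of `X` tangent to the leaves. -/
def leafPart (g : Metric I M) (N X : VField I M) : VField I M :=
  fun p => X p - g.inner p (X p) (N p) • N p

/-- The second fundamental form `b(X, Y) = g(∇_X Y, N)` of the foliation with unit normal `N`, for
`X`, `Y` tangent to the leaves, extended to all vector fields by `b(N, ·) = b(·, N) = 0`. -/
def secondForm (g : Metric I M) (N X Y : VField I M) : M → ℝ :=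
  leviCivita g (leafPart g N X) (leafPart g N Y) N

/-- The Lie derivative along `N` of a `(0,2)`-tensor `α`, given by its values on vector fields:
`(L_N α)(X, Y) = N(α(X, Y)) - α([N, X], Y) - α(X, [N, Y])`. -/
def lieDeriv (N : VField I M) (α : VField I M → VField I M → M → ℝ) (X Y : VField I M) : M → ℝ :=
  dirDeriv N (α X Y) - α (VectorField.mlieBracket I N X) Y - α X (VectorField.mlieBracket I N Y)

/-- `g t`, `t ∈ J`, is a smooth solution of the extrinsic geometric flow `∂ₜ g = -2 L_N b`
through metrics adapted to `(D, N)`. Smoothness is joint smoothness in time and space; at an end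
point of `J` time derivatives are one-sided. -/
structure IsFlowSolution (D : ∀ p : M, Submodule ℝ (TangentSpace I p)) (N : VField I M)
    (J : Set ℝ) (g : ℝ → Metric I M) : Prop where
  adapted : ∀ t ∈ J, IsAdapted D N (g t)
  smooth : ContMDiffOn (𝓘(ℝ, ℝ).prod I) (I.prod 𝓘(ℝ, E →L[ℝ] E →L[ℝ] ℝ)) ∞
    (fun q : ℝ × M => TotalSpace.mk' (E →L[ℝ] E →L[ℝ] ℝ)
      (E := fun p : M => TangentSpace I p →L[ℝ] TangentSpace I p →L[ℝ] ℝ)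
      q.2 ((g q.1).inner q.2)) (J ×ˢ univ)
  flow : ∀ t ∈ J, ∀ X Y : VField I M, IsSmoothField I X → IsSmoothField I Y → ∀ p : M,
    HasDerivWithinAt (fun s => (g s).app X Y p)
      (-2 * lieDeriv N (secondForm (g t) N) X Y p) J t

/-- Convergence `g t → g∞` in `C⁰`, uniformly on `M`, as `t → ∞`: the norm of the symmetric
bilinear form `g t - g∞`, measured with `g∞`, tends to zero uniformly. -/
def ConvergesC0 (g : ℝ → Metric I M) (gInf : Metric I M) : Prop :=
  ∀ ε > 0, ∀ᶠ t in atTop, ∀ (p : M) (v : TangentSpace I p),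
    |(g t).inner p v v - gInf.inner p v v| ≤ ε * gInf.inner p v v

end General

section TwistedProduct

variable {n : ℕ} {M₁ : Type*} [TopologicalSpace M₁] [ChartedSpace (EuclideanSpace ℝ (Fin n)) M₁]
  [IsManifold (𝓡 n) ∞ M₁]

/-- The tangent distribution of the foliation of `M₁ × S¹` by the leaves `M₁ × {y}`: the kernel of
the differential of the projection to `S¹`. -/
def leafDistribution (p : M₁ × Circle) : Submodule ℝ (TangentSpace ((𝓡 n).prod (𝓡 1)) p) :=
  LinearMap.ker (mfderiv ((𝓡 n).prod (𝓡 1)) (𝓡 1) (Prod.snd : M₁ × Circle → Circle) p).toLinearMap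

/-- The lift to `M₁ × S¹` of a vector field on `S¹`, tangent to the fibres `{x} × S¹`. -/
def fibreLift (N : VField (𝓡 1) Circle) : VField ((𝓡 n).prod (𝓡 1)) (M₁ × Circle) :=
  fun p => mfderiv (𝓡 1) ((𝓡 n).prod (𝓡 1)) (fun y : Circle => (p.1, y)) p.2 (N p.2)

/-- `g` is the direct sum `(c · g₁) ⊕ g₂` on `M₁ × S¹`, where `c` is a function on `M₁ × S¹`. -/
def IsScaledSum (g₁ : Metric (𝓡 n) M₁) (g₂ : Metric (𝓡 1) Circle) (c : M₁ × Circle → ℝ)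
    (g : Metric ((𝓡 n).prod (𝓡 1)) (M₁ × Circle)) : Prop :=
  ∀ (p : M₁ × Circle) (v w : TangentSpace ((𝓡 n).prod (𝓡 1)) p),
    g.inner p v w =
      c p * g₁.inner p.1
        (mfderiv ((𝓡 n).prod (𝓡 1)) (𝓡 n) (Prod.fst : M₁ × Circle → M₁) p v)
        (mfderiv ((𝓡 n).prod (𝓡 1)) (𝓡 n) (Prod.fst : M₁ × Circle → M₁) p w)
      + g₂.inner p.2
        (mfderiv ((𝓡 n).prod (𝓡 1)) (𝓡 1) (Prod.snd : M₁ × Circle → Circle) p v)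
        (mfderiv ((𝓡 n).prod (𝓡 1)) (𝓡 1) (Prod.snd : M₁ × Circle → Circle) p w)

/-- `g` is the metric `(f² g₁) ⊕ g₂` of the twisted product `M₁ ×_f S¹`. -/
def IsTwistedProduct (g₁ : Metric (𝓡 n) M₁) (g₂ : Metric (𝓡 1) Circle) (f : M₁ × Circle → ℝ)
    (g : Metric ((𝓡 n).prod (𝓡 1)) (M₁ × Circle)) : Prop :=
  IsScaledSum g₁ g₂ (fun p => f p ^ 2) g

/-- `g` is the metric of the Riemannian product `(M₁, h₁) × (S¹, g₂)`. -/
def IsProductMetric (h₁ : Metric (𝓡 n) M₁) (g₂ : Metric (𝓡 1) Circle)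
    (g : Metric ((𝓡 n).prod (𝓡 1)) (M₁ × Circle)) : Prop :=
  IsScaledSum h₁ g₂ (fun _ => 1) g

/-- The `g₂`-speed of the parametrization `θ ↦ exp(iθ)` of the circle. -/
def circleSpeed (g₂ : Metric (𝓡 1) Circle) (θ : ℝ) : ℝ :=
  Real.sqrt (g₂.inner (Circle.exp θ)
    (mfderiv 𝓘(ℝ, ℝ) (𝓡 1) (fun s : ℝ => Circle.exp s) θ (1 : ℝ))
    (mfderiv 𝓘(ℝ, ℝ) (𝓡 1) (fun s : ℝ => Circle.exp s) θ (1 : ℝ)))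

/-- The integral of `h` over the circle with respect to the arc length of `g₂`. -/
def circleIntegral (g₂ : Metric (𝓡 1) Circle) (h : Circle → ℝ) : ℝ :=
  ∫ θ in (0 : ℝ)..(2 * Real.pi), h (Circle.exp θ) * circleSpeed g₂ θ

/-- The mean value of `h` over the circle with respect to the arc length of `g₂`. -/
def circleMean (g₂ : Metric (𝓡 1) Circle) (h : Circle → ℝ) : ℝ :=
  circleIntegral g₂ h / circleIntegral g₂ (fun _ => 1)

end TwistedProduct

end ExtrinsicFlow

end

/-! The flow is a linear heat equation on each circle in disguise. For an adapted metric the Koszul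
formula gives `b = -(1/2) L_N g` on vectors tangent to the leaves, so `-2 L_N b` is the second Lie
derivative of the leaf metric along `N`. Parametrize the circle by an integral curve `γ` of `N`, of
period `ℓ`. For fixed `x` and fixed `v`, `w` tangent to `M₁` at `x`, the coefficient `g_t(v, w)` at
`(x, γ s)` then satisfies `∂_t = ∂_s ∂_s` in the one variable `s`, with `x` a mere parameter
(`secondForm_eq`, `lieDeriv_secondForm_eq`). The remaining components of the metric are fixed by
adaptedness (`eq_of_leafForm_eq`).

Existence: if `c_t` solves the heat equation along the fibres with `c_0 = f ^ 2`, then `(c_t g₁) ⊕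
g₂` solves the flow. The solution `c_t` is the average of the periodic lift of `f ^ 2` against a
Gaussian of variance `2 t` (`fibreHeat`). Averaging keeps the positive lower bound that `f ^ 2` has
by compactness, so `f_t = √c_t` is smooth and positive.

Stein's lemma `∫ z φ(z) = ∫ φ'(z)` for the standard Gaussian does the analysis twice. It trades the
singular factor `1 / √(2 t)` in the time derivative for a second space derivative, which gives
smoothness up to `t = 0`. Applied to the periodic primitive of `φ - mean φ`, it bounds the distance
from the Gaussian average to the mean by a constant over `√(2 t)`, which gives the uniform
convergence.

Uniqueness: the coefficients of two solutions, on fixed `v` and `w`, are periodic solutions of the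
same heat equation with the same initial value, and the maximum principle makes them equal
(`heat_unique`). No twisted product form is assumed of the competing solution. -/

noncomputable section

open MeasureTheory ProbabilityTheory

namespace ExtrinsicFlow

/-! ### Gaussian averages and the heat equation in one direction of a normed space. -/

section Heat

/-- Smooth maps all of whose derivatives are bounded. -/
def BddSmooth {W V : Type*} [NormedAddCommGroup W] [NormedSpace ℝ W] [NormedAddCommGroup V]
    [NormedSpace ℝ V] (F : W → V) : Prop :=
  ContDiff ℝ ∞ F ∧ ∀ k : ℕ, ∃ C : ℝ, ∀ w, ‖iteratedFDeriv ℝ k F w‖ ≤ C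

/-- The solution at time `t` of the heat equation in the direction `e` with initial value `F`:
the average of `F` on the line through `w` against a Gaussian of variance `2 t`. -/
def gaussHeat {W V : Type*} [NormedAddCommGroup W] [NormedSpace ℝ W] [NormedAddCommGroup V]
    [NormedSpace ℝ V] (e : W) (F : W → V) (t : ℝ) (w : W) : V :=
  ∫ z, F (w + (√(2 * t) * z) • e) ∂(gaussianReal 0 1)

variable {W V V' : Type*} [NormedAddCommGroup W] [NormedSpace ℝ W] [NormedAddCommGroup V]
  [NormedSpace ℝ V] [NormedAddCommGroup V'] [NormedSpace ℝ V']

namespace BddSmooth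

variable {F : W → V}

theorem continuous (hF : BddSmooth F) : Continuous F := hF.1.continuous

theorem bound (hF : BddSmooth F) : ∃ C, ∀ w, ‖F w‖ ≤ C := by
  obtain ⟨C, hC⟩ := hF.2 0
  exact ⟨C, fun w => by simpa using hC w⟩

theorem fderiv (hF : BddSmooth F) : BddSmooth (fderiv ℝ F) := by
  refine ⟨hF.1.fderiv_right (m := ∞) (by simp), fun k => ?_⟩
  obtain ⟨C, hC⟩ := hF.2 (k + 1)
  exact ⟨C, fun w => by rw [norm_iteratedFDeriv_fderiv]; exact hC w⟩

theorem clm_comp (hF : BddSmooth F) (A : V →L[ℝ] V') : BddSmooth (fun w => A (F w)) := by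
  refine ⟨A.contDiff.comp hF.1, fun k => ?_⟩
  obtain ⟨C, hC⟩ := hF.2 k
  refine ⟨‖A‖ * C, fun w => ?_⟩
  refine (A.norm_iteratedFDeriv_comp_left hF.1.contDiffAt (n := k)
    (by exact_mod_cast le_top)).trans ?_
  gcongr
  exact hC w

theorem hasFDerivAt (hF : BddSmooth F) (w : W) : HasFDerivAt F (_root_.fderiv ℝ F w) w :=
  (hF.1.differentiable (by simp) w).hasFDerivAt

theorem dirDeriv (hF : BddSmooth F) (e : W) : BddSmooth (fun w => _root_.fderiv ℝ F w e) :=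
  hF.fderiv.clm_comp (ContinuousLinearMap.apply ℝ V e)

theorem integrable_comp (hF : BddSmooth F) {μ : Measure ℝ} [IsFiniteMeasure μ] {ψ : ℝ → W}
    (hψ : Continuous ψ) : Integrable (fun z => F (ψ z)) μ := by
  obtain ⟨C, hC⟩ := hF.bound
  exact Integrable.of_bound (hF.continuous.comp hψ).aestronglyMeasurable C
    (ae_of_all _ fun z => hC _)

end BddSmooth

theorem integrable_norm_gaussian : Integrable (fun z : ℝ => |z|) (gaussianReal 0 1) :=
  ((memLp_id_gaussianReal 1).integrable (by simp)).abs

theorem hasDerivAt_gaussianPDFReal (z : ℝ) :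
    HasDerivAt (gaussianPDFReal 0 1) (-z * gaussianPDFReal 0 1 z) z := by
  have h : gaussianPDFReal 0 1 = fun x => (√(2 * Real.pi))⁻¹ * Real.exp (-x ^ 2 / 2) := by
    ext x; simp [gaussianPDFReal]
  rw [h]
  have h1 : HasDerivAt (fun x : ℝ => -x ^ 2 / 2) (-z) z := by
    refine (((hasDerivAt_pow 2 z).neg).div_const 2).congr_deriv ?_
    simp; ring
  refine ((h1.exp).const_mul ((√(2 * Real.pi))⁻¹)).congr_deriv ?_
  ring

/-- Passing to Lebesgue measure with the density as a factor makes integration by parts on the line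
available. -/
theorem integrable_smul_gaussian_iff {φ : ℝ → V} :
    Integrable φ (gaussianReal 0 1) ↔ Integrable (fun z => gaussianPDFReal 0 1 z • φ z) := by
  rw [gaussianReal_of_var_ne_zero _ one_ne_zero, gaussianPDF_def,
    integrable_withDensity_iff_integrable_smul₀' (by fun_prop)
    (ae_of_all _ fun x => by simp)]
  refine integrable_congr (ae_of_all _ fun x => ?_)
  simp [ENNReal.toReal_ofReal (gaussianPDFReal_nonneg 0 1 x)]

/-- **Stein's lemma**: integration by parts for the standard Gaussian. -/
theorem integral_smul_gaussian_eq_deriv {φ φ' : ℝ → V} {C C' : ℝ}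
    (hφ : ∀ z, HasDerivAt φ (φ' z) z) (hφ' : Continuous φ') (hC : ∀ z, ‖φ z‖ ≤ C)
    (hC' : ∀ z, ‖φ' z‖ ≤ C') :
    ∫ z, z • φ z ∂(gaussianReal 0 1) = ∫ z, φ' z ∂(gaussianReal 0 1) := by
  have hc : Continuous φ := continuous_iff_continuousAt.2 fun z => (hφ z).continuousAt
  have i1 : Integrable φ (gaussianReal 0 1) :=
    Integrable.of_bound hc.aestronglyMeasurable C (ae_of_all _ hC)
  have i2 : Integrable φ' (gaussianReal 0 1) :=
    Integrable.of_bound hφ'.aestronglyMeasurable C' (ae_of_all _ hC')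
  have i3 : Integrable (fun z => z • φ z) (gaussianReal 0 1) := by
    refine Integrable.mono' (integrable_norm_gaussian.mul_const C)
      (by fun_prop) (ae_of_all _ fun z => ?_)
    rw [norm_smul, Real.norm_eq_abs]
    gcongr
    exact hC z
  rw [integrable_smul_gaussian_iff] at i1 i2 i3
  rw [integral_gaussianReal_eq_integral_smul one_ne_zero,
    integral_gaussianReal_eq_integral_smul one_ne_zero]
  -- The derivative of the density is `-z` times the density; integrability of all the products
  -- replaces boundary terms.
  have key := integral_bilinear_hasDerivAt_right_eq_neg_left_of_integrable
    (L := ContinuousLinearMap.lsmul ℝ ℝ (E := V)) (u := gaussianPDFReal 0 1) (v := φ)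
    (fun z _ => hasDerivAt_gaussianPDFReal z) (fun z _ => hφ z) i2
    (by
      refine i3.neg.congr (ae_of_all _ fun z => ?_)
      simp [smul_smul, mul_comm]) i1
  simp only [ContinuousLinearMap.lsmul_apply] at key
  rw [key, ← integral_neg]
  refine integral_congr_ae (ae_of_all _ fun z => ?_)
  simp [smul_smul, mul_comm]

/-- The measure is left general because two are needed: the Gaussian for the heat flow and Lebesgue
measure on one period for the mean value. -/
theorem hasFDerivAt_integral_translate {F : W → V} (hF : BddSmooth F) {μ : Measure ℝ}
    [IsFiniteMeasure μ] {ψ : ℝ → W} (hψ : Continuous ψ) (w : W) :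
    HasFDerivAt (fun w => ∫ z, F (w + ψ z) ∂μ) (∫ z, fderiv ℝ F (w + ψ z) ∂μ) w := by
  obtain ⟨C, hC⟩ := hF.fderiv.bound
  refine hasFDerivAt_integral_of_dominated_of_fderiv_le (bound := fun _ => C)
    (F := fun w z => F (w + ψ z)) (F' := fun w z => fderiv ℝ F (w + ψ z)) univ_mem
    (Eventually.of_forall fun w => ?_) ?_ ?_ (ae_of_all _ fun z w _ => hC _)
    (integrable_const _) (ae_of_all _ fun z w _ => ?_)
  · exact (hF.continuous.comp (by fun_prop)).aestronglyMeasurable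
  · exact hF.integrable_comp (by fun_prop)
  · exact (hF.fderiv.continuous.comp (by fun_prop)).aestronglyMeasurable
  · exact HasFDerivAt.comp w (hF.hasFDerivAt (w + ψ z)) ((hasFDerivAt_id w).add_const (ψ z))

/-- The derivative is an integral of the same kind with `fderiv ℝ F` in place of `F`, so the
induction runs over all target spaces at once. `W` and `V` lie in one universe, so that `W →L[ℝ] V`
is again an admissible target. -/
theorem contDiff_integral_translate_nat {W : Type} [NormedAddCommGroup W] [NormedSpace ℝ W]
    {μ : Measure ℝ} [IsFiniteMeasure μ] {ψ : ℝ → W} (hψ : Continuous ψ) (n : ℕ) :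
    ∀ {V : Type} [NormedAddCommGroup V] [NormedSpace ℝ V] {F : W → V}, BddSmooth F →
      ContDiff ℝ n (fun w => ∫ z, F (w + ψ z) ∂μ) := by
  induction n with
  | zero =>
    intro V _ _ F hF
    exact contDiff_zero.2 (continuous_iff_continuousAt.2 fun w =>
      (hasFDerivAt_integral_translate hF hψ w).continuousAt)
  | succ n ih =>
    intro V _ _ F hF
    rw [Nat.cast_succ, contDiff_succ_iff_hasFDerivAt]
    exact ⟨_, ih hF.fderiv, hasFDerivAt_integral_translate hF hψ⟩

theorem contDiff_integral_translate {W V : Type} [NormedAddCommGroup W] [NormedSpace ℝ W]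
    [NormedAddCommGroup V] [NormedSpace ℝ V] {F : W → V} (hF : BddSmooth F)
    {μ : Measure ℝ} [IsFiniteMeasure μ] {ψ : ℝ → W} (hψ : Continuous ψ) :
    ContDiff ℝ ∞ (fun w => ∫ z, F (w + ψ z) ∂μ) :=
  contDiff_infty.2 fun n => contDiff_integral_translate_nat hψ n hF

theorem continuous_gaussHeat {F : W → V} (hF : BddSmooth F) (e : W) :
    Continuous (fun q : ℝ × W => gaussHeat e F q.1 q.2) := by
  obtain ⟨C, hC⟩ := hF.bound
  refine continuous_of_dominated (bound := fun _ => C) (fun q => ?_)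
    (fun q => ae_of_all _ fun z => hC _) (integrable_const _) (ae_of_all _ fun z => ?_)
  · exact (hF.continuous.comp (by fun_prop)).aestronglyMeasurable
  · exact hF.continuous.comp (by fun_prop)

/-- The derivative of a solution of the heat equation. -/
def gaussHeatDeriv (e : W) (F : W → V) (q : ℝ × W) : ℝ × W →L[ℝ] V :=
  (ContinuousLinearMap.fst ℝ ℝ W).smulRight
      (gaussHeat e (fun w => fderiv ℝ (fun w => fderiv ℝ F w e) w e) q.1 q.2) +
    (gaussHeat e (fderiv ℝ F) q.1 q.2).comp (ContinuousLinearMap.snd ℝ ℝ W)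

/-- In the variables `(ρ, w)` with `ρ = √(2 t)` the integrand is `F` composed with a linear map, and
differentiation under the integral is dominated by an affine function of `|z|`. The chain rule then
brings in `ρ⁻¹ ∫ z ∂_e F`, which Stein's lemma turns into `∫ ∂_e ∂_e F`. -/
theorem hasFDerivAt_gaussHeat_of_pos [CompleteSpace V] {F : W → V} (hF : BddSmooth F) (e : W)
    {q : ℝ × W} (hq : 0 < q.1) :
    HasFDerivAt (fun q : ℝ × W => gaussHeat e F q.1 q.2) (gaussHeatDeriv e F q) q := by
  obtain ⟨C, hC⟩ := hF.fderiv.bound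
  set ρ : ℝ := √(2 * q.1) with hρ
  have hρ0 : 0 < ρ := Real.sqrt_pos.2 (by linarith)
  -- The linear map `(ρ, w) ↦ w + ρ z e`.
  let A : ℝ → (ℝ × W →L[ℝ] W) := fun z =>
    ContinuousLinearMap.snd ℝ ℝ W + (ContinuousLinearMap.fst ℝ ℝ W).smulRight (z • e)
  have hA : Continuous A := by
    have : A = fun z => ContinuousLinearMap.snd ℝ ℝ W +
      z • (ContinuousLinearMap.fst ℝ ℝ W).smulRight e := by
      ext z p <;> simp [A, smul_smul, mul_comm]
    rw [this]; fun_prop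
  have hAn : ∀ z, ‖A z‖ ≤ 1 + |z| * ‖e‖ := fun z => by
    refine (norm_add_le _ _).trans (add_le_add (ContinuousLinearMap.norm_snd_le ℝ ℝ W) ?_)
    rw [ContinuousLinearMap.norm_smulRight_apply, norm_smul, Real.norm_eq_abs]
    calc _ ≤ 1 * (|z| * ‖e‖) := by
          gcongr; exact ContinuousLinearMap.norm_fst_le ℝ ℝ W
      _ = _ := one_mul _
  have hAev : ∀ z (p : ℝ × W), A z p = p.2 + (p.1 * z) • e := fun z p => by
    simp [A, smul_smul]
  have hC0 : 0 ≤ C := (norm_nonneg _).trans (hC 0)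
  have hbi : Integrable (fun z : ℝ => C * (1 + |z| * ‖e‖)) (gaussianReal 0 1) :=
    ((integrable_const 1).add (integrable_norm_gaussian.mul_const _)).const_mul C
  have h1 : HasFDerivAt (fun p : ℝ × W => ∫ z, F (A z p) ∂(gaussianReal 0 1))
      (∫ z, (fderiv ℝ F (A z (ρ, q.2))).comp (A z) ∂(gaussianReal 0 1)) (ρ, q.2) := by
    refine hasFDerivAt_integral_of_dominated_of_fderiv_le
      (bound := fun z => C * (1 + |z| * ‖e‖))
      (F := fun p z => F (A z p)) (F' := fun p z => (fderiv ℝ F (A z p)).comp (A z)) univ_mem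
      (Eventually.of_forall fun w => ?_) ?_ ?_ (ae_of_all _ fun z w _ => ?_)
      hbi (ae_of_all _ fun z w _ => ?_)
    · exact (hF.continuous.comp (by fun_prop)).aestronglyMeasurable
    · exact hF.integrable_comp (by fun_prop)
    · have := hF.fderiv.continuous
      exact Continuous.aestronglyMeasurable (by fun_prop)
    · refine (ContinuousLinearMap.opNorm_comp_le _ _).trans ?_
      gcongr
      exacts [hC _, hAn z]
    · exact (hF.hasFDerivAt _).comp w (A z).hasFDerivAt
  have hsq : HasDerivAt (fun t : ℝ => √(2 * t)) ρ⁻¹ q.1 := by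
    refine (((hasDerivAt_id q.1).const_mul 2).sqrt (by simp; linarith)).congr_deriv ?_
    simp only [id, ← hρ]
    field_simp
  have h2 : HasFDerivAt (fun q : ℝ × W => (√(2 * q.1), q.2))
      (((ContinuousLinearMap.fst ℝ ℝ W).smulRight ρ⁻¹).prod (ContinuousLinearMap.snd ℝ ℝ W)) q := by
    refine HasFDerivAt.prodMk ?_ hasFDerivAt_snd
    refine (hsq.hasFDerivAt.comp q hasFDerivAt_fst).congr_fderiv ?_
    ext <;> simp
  have h3 := HasFDerivAt.comp q (g := fun p : ℝ × W => ∫ z, F (A z p) ∂(gaussianReal 0 1)) h1 h2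
  have hint : Integrable (fun z => (fderiv ℝ F (A z (ρ, q.2))).comp (A z)) (gaussianReal 0 1) := by
    have := hF.fderiv.continuous
    refine Integrable.mono' hbi (Continuous.aestronglyMeasurable (by fun_prop))
      (ae_of_all _ fun z => ?_)
    refine (ContinuousLinearMap.opNorm_comp_le _ _).trans ?_
    gcongr
    exacts [hC _, hAn z]
  have hint1 : Integrable (fun z => fderiv ℝ F (A z (ρ, q.2))) (gaussianReal 0 1) :=
    hF.fderiv.integrable_comp (by fun_prop)
  have h4 : (fun q : ℝ × W => gaussHeat e F q.1 q.2) =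
      (fun p => ∫ z, F (A z p) ∂gaussianReal 0 1) ∘ fun q => (√(2 * q.1), q.2) := by
    ext p
    simp [gaussHeat, hAev]
  rw [h4]
  refine h3.congr_fderiv (Eq.symm ?_)
  · refine ContinuousLinearMap.ext fun p => ?_
    change p.1 • gaussHeat e (fun w => fderiv ℝ (fun w => fderiv ℝ F w e) w e) q.1 q.2 +
      gaussHeat e (fderiv ℝ F) q.1 q.2 p.2 =
      (∫ z, (fderiv ℝ F (A z (ρ, q.2))).comp (A z) ∂gaussianReal 0 1) (p.1 • ρ⁻¹, p.2)
    rw [ContinuousLinearMap.integral_apply hint]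
    have hs : ∀ z : ℝ, A z (ρ, q.2) = q.2 + (ρ * z) • e := fun z => hAev z _
    have i2 : Integrable (fun z => fderiv ℝ F (A z (ρ, q.2)) p.2) (gaussianReal 0 1) :=
      hint1.apply_continuousLinearMap _
    obtain ⟨C1, hC1⟩ := (hF.dirDeriv e).bound
    obtain ⟨C2, hC2⟩ := ((hF.dirDeriv e).dirDeriv e).bound
    have i3 : Integrable (fun z : ℝ => z • fderiv ℝ F (A z (ρ, q.2)) e) (gaussianReal 0 1) := by
      have := hF.fderiv.continuous
      refine Integrable.mono' (integrable_norm_gaussian.mul_const C1)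
        (Continuous.aestronglyMeasurable (by fun_prop)) (ae_of_all _ fun z => ?_)
      rw [norm_smul, Real.norm_eq_abs]
      gcongr
      exact hC1 _
    have e1 : ∀ z, ((fderiv ℝ F (A z (ρ, q.2))).comp (A z)) (p.1 • ρ⁻¹, p.2) =
        fderiv ℝ F (A z (ρ, q.2)) p.2 + (p.1 * ρ⁻¹) • (z • fderiv ℝ F (A z (ρ, q.2)) e) := by
      intro z
      simp only [ContinuousLinearMap.comp_apply]
      rw [hAev z (p.1 • ρ⁻¹, p.2), map_add, map_smul, smul_smul, smul_eq_mul]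
    simp only [e1]
    rw [integral_add i2 (by exact i3.smul _), integral_smul]
    -- Differentiating in `z` along `w + ρ z e` produces the factor `ρ` that cancels `ρ⁻¹`.
    have stein := integral_smul_gaussian_eq_deriv
      (φ := fun z => fderiv ℝ F (A z (ρ, q.2)) e)
      (φ' := fun z => ρ • fderiv ℝ (fun w => fderiv ℝ F w e) (A z (ρ, q.2)) e)
      (C := C1) (C' := ρ * C2) (fun z => ?_) ?_ (fun z => hC1 _) (fun z => ?_)
    · rw [stein, integral_smul, smul_smul, mul_assoc, inv_mul_cancel₀ hρ0.ne', mul_one, add_comm]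
      congr 1
      · simp only [gaussHeat, hs]
        rw [ContinuousLinearMap.integral_apply]
        exact hF.fderiv.integrable_comp (by fun_prop)
      · simp only [gaussHeat, hs, ← hρ]
    · have hl : HasDerivAt (fun z : ℝ => A z (ρ, q.2)) (ρ • e) z := by
        simp only [hs]
        simpa using (((hasDerivAt_id z).const_mul ρ).smul_const e).const_add q.2
      exact (((hF.dirDeriv e).hasFDerivAt (A z (ρ, q.2))).comp_hasDerivAt z hl).congr_deriv
        (map_smul _ _ _)
    · have := ((hF.dirDeriv e).dirDeriv e).continuous
      exact (this.comp (by fun_prop)).const_smul ρ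
    · rw [norm_smul, Real.norm_eq_abs, abs_of_pos hρ0]
      gcongr
      exact hC2 _

theorem hasFDerivWithinAt_gaussHeat [CompleteSpace V] {F : W → V} (hF : BddSmooth F) (e : W)
    (q : ℝ × W) :
    HasFDerivWithinAt (fun q : ℝ × W => gaussHeat e F q.1 q.2) (gaussHeatDeriv e F q)
      (Ici 0 ×ˢ univ) q := by
  have hcl : closure (Ioi (0 : ℝ) ×ˢ (univ : Set W)) = Ici 0 ×ˢ univ := by
    rw [closure_prod_eq, closure_Ioi, closure_univ]
  have hop : IsOpen (Ioi (0 : ℝ) ×ˢ (univ : Set W)) := isOpen_Ioi.prod isOpen_univ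
  rw [← hcl]
  -- Although `√(2 t)` is not differentiable at `0`, the formula for the derivative at positive
  -- times is continuous up to `t = 0`, and so it is the one-sided derivative there.
  refine hasFDerivWithinAt_closure_of_tendsto_fderiv (fun p hp =>
    (hasFDerivAt_gaussHeat_of_pos hF e hp.1).differentiableAt.differentiableWithinAt)
    ((convex_Ioi 0).prod convex_univ) hop
    (fun p _ => (continuous_gaussHeat hF e).continuousWithinAt) ?_
  have hcont : Continuous (gaussHeatDeriv e F) := by
    have h1 := continuous_gaussHeat ((hF.dirDeriv e).dirDeriv e) e
    have h2 := continuous_gaussHeat hF.fderiv e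
    unfold gaussHeatDeriv
    have h3 : Continuous fun q : ℝ × W => (ContinuousLinearMap.smulRightL ℝ (ℝ × W) V
      (ContinuousLinearMap.fst ℝ ℝ W))
        (gaussHeat e (fun w => fderiv ℝ (fun w => fderiv ℝ F w e) w e) q.1 q.2) :=
      (ContinuousLinearMap.continuous _).comp h1
    exact h3.add (h2.clm_comp continuous_const)
  refine (hcont.continuousAt.tendsto.mono_left nhdsWithin_le_nhds).congr' ?_
  filter_upwards [self_mem_nhdsWithin] with p hp
  exact (hasFDerivAt_gaussHeat_of_pos hF e hp.1).fderiv.symm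

/-- The derivative is assembled linearly from the Gaussian averages of `∂_e ∂_e F` and of `fderiv ℝ
F`, both bounded smooth again. The second has a new target space, hence the quantification over `V`
inside the induction. -/
theorem contDiffOn_gaussHeat_nat {W : Type} [NormedAddCommGroup W] [NormedSpace ℝ W]
    (e : W) (n : ℕ) :
    ∀ {V : Type} [NormedAddCommGroup V] [NormedSpace ℝ V] [CompleteSpace V] {F : W → V},
      BddSmooth F →
      ContDiffOn ℝ n (fun q : ℝ × W => gaussHeat e F q.1 q.2) (Ici 0 ×ˢ univ) := by
  induction n with
  | zero =>
    intro V _ _ _ F hF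
    exact contDiffOn_zero.2 (continuous_gaussHeat hF e).continuousOn
  | succ n ih =>
    intro V _ _ _ F hF
    have hu : UniqueDiffOn ℝ (Ici (0 : ℝ) ×ˢ (univ : Set W)) :=
      (uniqueDiffOn_Ici 0).prod uniqueDiffOn_univ
    rw [Nat.cast_succ, contDiffOn_succ_iff_fderivWithin hu]
    refine ⟨fun q _ => (hasFDerivWithinAt_gaussHeat hF e q).differentiableWithinAt,
      by simp, ?_⟩
    have h : ContDiffOn ℝ n (gaussHeatDeriv e F) (Ici 0 ×ˢ univ) := by
      have h1 := ih ((hF.dirDeriv e).dirDeriv e)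
      have h2 := ih hF.fderiv
      unfold gaussHeatDeriv
      have h3 : ContDiffOn ℝ n (fun q : ℝ × W => (ContinuousLinearMap.smulRightL ℝ (ℝ × W) V
        (ContinuousLinearMap.fst ℝ ℝ W))
          (gaussHeat e (fun w => fderiv ℝ (fun w => fderiv ℝ F w e) w e) q.1 q.2))
          (Ici 0 ×ˢ univ) :=
        (ContinuousLinearMap.contDiff _).comp_contDiffOn h1
      exact h3.add (h2.clm_comp contDiffOn_const)
    exact h.congr fun q hq => (hasFDerivWithinAt_gaussHeat hF e q).fderivWithin (hu q hq)

/-- Solutions of the heat equation are smooth up to time zero. -/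
theorem contDiffOn_gaussHeat {W V : Type} [NormedAddCommGroup W] [NormedSpace ℝ W]
    [NormedAddCommGroup V] [NormedSpace ℝ V] [CompleteSpace V] {F : W → V} (hF : BddSmooth F)
    (e : W) :
    ContDiffOn ℝ ∞ (fun q : ℝ × W => gaussHeat e F q.1 q.2) (Ici 0 ×ˢ univ) :=
  contDiffOn_infty.2 fun n => contDiffOn_gaussHeat_nat e n hF

theorem hasDerivWithinAt_gaussHeat_time [CompleteSpace V] {F : W → V} (hF : BddSmooth F) (e : W)
    (t : ℝ) (w : W) :
    HasDerivWithinAt (fun t => gaussHeat e F t w)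
      (gaussHeat e (fun w => fderiv ℝ (fun w => fderiv ℝ F w e) w e) t w) (Ici 0) t := by
  have h := (hasFDerivWithinAt_gaussHeat hF e (t, w)).comp_hasDerivWithinAt
    (f := fun t => (t, w)) (f' := ((1 : ℝ), (0 : W))) (s := Ici 0) t
    ((hasDerivWithinAt_id t _).prodMk (hasDerivWithinAt_const t _ w)) (fun s hs => ⟨hs, mem_univ _⟩)
  refine (h.congr_deriv ?_ : _)
  simp [gaussHeatDeriv]

theorem hasDerivAt_gaussHeat_line [CompleteSpace V] {F : W → V} (hF : BddSmooth F) (e : W)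
    (t : ℝ) (w : W) (s : ℝ) :
    HasDerivAt (fun s : ℝ => gaussHeat e F t (w + s • e))
      (gaussHeat e (fun w => fderiv ℝ F w e) t (w + s • e)) s := by
  have h1 := hasFDerivAt_integral_translate hF (μ := gaussianReal 0 1)
    (ψ := fun z => (√(2 * t) * z) • e) (by fun_prop) (w + s • e)
  have h2 : HasDerivAt (fun s : ℝ => w + s • e) e s := by
    simpa using ((hasDerivAt_id s).smul_const e).const_add w
  have h3 := h1.comp_hasDerivAt s h2
  rw [ContinuousLinearMap.integral_apply (hF.fderiv.integrable_comp (by fun_prop))] at h3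
  exact h3

end Heat

/-! ### Periodic functions: bounds, convergence to the mean, the maximum principle. -/

section Periodic

/-- The iterated derivatives are themselves periodic and vanish off `K`, so their bounds on the
compact set `K × [0, ℓ]` hold everywhere. -/
theorem BddSmooth.of_periodic {E V : Type*} [NormedAddCommGroup E] [NormedSpace ℝ E]
    [NormedAddCommGroup V] [NormedSpace ℝ V] {F : E × ℝ → V} (hF : ContDiff ℝ ∞ F)
    {ℓ : ℝ} (hℓ : 0 < ℓ) (hper : ∀ x s, F (x, s + ℓ) = F (x, s)) {K : Set E} (hK : IsCompact K)
    (hFK : ∀ x ∉ K, ∀ s, F (x, s) = 0) : BddSmooth F := by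
  refine ⟨hF, fun k => ?_⟩
  have hc : Continuous (iteratedFDeriv ℝ k F) :=
    hF.continuous_iteratedFDeriv (by exact_mod_cast le_top)
  obtain ⟨C, hC⟩ := (hK.prod (isCompact_Icc (a := (0 : ℝ)) (b := ℓ))).exists_bound_of_continuousOn
    hc.continuousOn
  refine ⟨max C 0, fun w => ?_⟩
  by_cases hw : w.1 ∈ K
  · have hp : Function.Periodic (fun s => iteratedFDeriv ℝ k F (w.1, s)) ℓ := fun s => by
      have h1 : F = fun z => F (z + (0, ℓ)) := by
        ext ⟨x, s⟩; simp [hper]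
      have h2 := iteratedFDeriv_comp_add_right (𝕜 := ℝ) (f := F) k (0, ℓ) (w.1, s)
      rw [← h1] at h2
      simpa using h2.symm
    obtain ⟨s, hs, hs'⟩ := hp.exists_mem_Ico₀ hℓ w.2
    refine le_max_of_le_left ?_
    have h3 : iteratedFDeriv ℝ k F w = iteratedFDeriv ℝ k F (w.1, s) := hs'
    rw [h3]
    exact hC _ ⟨hw, hs.1, hs.2.le⟩
  · have h0 : F =ᶠ[𝓝 w] fun _ => 0 := by
      have : (Kᶜ ×ˢ univ : Set (E × ℝ)) ∈ 𝓝 w :=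
        (hK.isClosed.isOpen_compl.prod isOpen_univ).mem_nhds ⟨hw, mem_univ _⟩
      filter_upwards [this] with z hz
      exact hFK z.1 hz.1 z.2
    rw [(Filter.EventuallyEq.iteratedFDeriv ℝ h0 k).self_of_nhds]
    simp

/-- The Gaussian averages of a periodic function converge to its mean value. -/
theorem abs_gaussian_average_sub_mean_le {φ : ℝ → ℝ} (hφ : Continuous φ) {ℓ : ℝ} (hℓ : 0 < ℓ)
    (hper : Function.Periodic φ ℓ) {B : ℝ} (hB : ∀ s, |φ s| ≤ B) {ρ : ℝ} (hρ : 0 < ρ) (s : ℝ) :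
    |∫ z, φ (s + ρ * z) ∂(gaussianReal 0 1) - (∫ u in (0 : ℝ)..ℓ, φ u) / ℓ| ≤
      2 * B * ℓ * (∫ z, |z| ∂(gaussianReal 0 1)) / ρ := by
  set m := (∫ u in (0 : ℝ)..ℓ, φ u) / ℓ with hm
  have hmB : |m| ≤ B := by
    rw [hm, abs_div, abs_of_pos hℓ, div_le_iff₀ hℓ]
    simpa [abs_of_pos hℓ] using
      intervalIntegral.norm_integral_le_of_norm_le_const (a := 0) (b := ℓ) (f := φ) (C := B)
        fun u _ => hB u
  have hψ : Continuous fun u => φ u - m := hφ.sub continuous_const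
  have hψB : ∀ u, |φ u - m| ≤ 2 * B := fun u =>
    (abs_sub _ _).trans (by linarith [hB u])
  -- Since `φ - m` has integral zero over a period, this primitive is periodic, hence bounded by `2
  -- B ℓ`.
  let K : ℝ → ℝ := fun u => ∫ v in (0 : ℝ)..u, (φ v - m)
  have hK : ∀ u, HasDerivAt K (φ u - m) u := fun u =>
    intervalIntegral.integral_hasDerivAt_right (hψ.intervalIntegrable _ _)
      (hψ.stronglyMeasurableAtFilter _ _) hψ.continuousAt
  have hKp : Function.Periodic K ℓ := fun u => by
    have h1 : K (u + ℓ) = K u + ∫ v in u..u + ℓ, (φ v - m) :=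
      (intervalIntegral.integral_add_adjacent_intervals (hψ.intervalIntegrable _ _)
        (hψ.intervalIntegrable _ _)).symm
    have hp : Function.Periodic (fun v => φ v - m) ℓ := fun v => by simp [hper v]
    rw [h1, hp.intervalIntegral_add_eq u 0, zero_add,
      intervalIntegral.integral_sub (hφ.intervalIntegrable _ _) (by simp)]
    simp only [hm, intervalIntegral.integral_const, smul_eq_mul, sub_zero]
    field_simp
    simp
  have hKB : ∀ u, |K u| ≤ 2 * B * ℓ := fun u => by
    obtain ⟨v, hv, hv'⟩ := hKp.exists_mem_Ico₀ hℓ u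
    rw [hv']
    have h2B : 0 ≤ 2 * B := (abs_nonneg _).trans (hψB 0)
    have := intervalIntegral.norm_integral_le_of_norm_le_const (a := 0) (b := v)
      (f := fun v => φ v - m) (C := 2 * B) fun u _ => hψB u
    rw [sub_zero, abs_of_nonneg hv.1] at this
    exact this.trans (by gcongr; exact hv.2.le)
  have hi : Integrable (fun z => φ (s + ρ * z)) (gaussianReal 0 1) :=
    Integrable.of_bound (hφ.comp (by fun_prop)).aestronglyMeasurable B (ae_of_all _ fun z => hB _)
  -- The result is `∫ z K(s + ρ z) = ρ (∫ φ(s + ρ z) - m)`; the left side stays bounded as `ρ`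
  -- grows.
  have stein := integral_smul_gaussian_eq_deriv (φ := fun z => K (s + ρ * z))
    (φ' := fun z => ρ * (φ (s + ρ * z) - m)) (C := 2 * B * ℓ) (C' := ρ * (2 * B))
    (fun z => by
      have hl : HasDerivAt (fun z : ℝ => s + ρ * z) ρ z := by
        simpa using ((hasDerivAt_id z).const_mul ρ).const_add s
      exact ((hK (s + ρ * z)).comp z hl).congr_deriv (mul_comm _ _))
    (by fun_prop) (fun z => hKB _)
    (fun z => by
      rw [norm_mul, Real.norm_eq_abs, abs_of_pos hρ]
      gcongr
      exact hψB _)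
  rw [integral_const_mul, integral_sub hi (integrable_const _)] at stein
  simp only [integral_const, probReal_univ, one_smul] at stein
  rw [le_div_iff₀ hρ]
  calc _ = |ρ * (∫ z, φ (s + ρ * z) ∂(gaussianReal 0 1) - m)| := by
        rw [abs_mul, abs_of_pos hρ, mul_comm]
    _ = |∫ z, z • K (s + ρ * z) ∂(gaussianReal 0 1)| := by rw [stein]
    _ ≤ ∫ z, 2 * B * ℓ * |z| ∂(gaussianReal 0 1) := by
        rw [← Real.norm_eq_abs]
        refine norm_integral_le_of_norm_le (integrable_norm_gaussian.const_mul _)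
          (ae_of_all _ fun z => ?_)
        rw [norm_smul, Real.norm_eq_abs, Real.norm_eq_abs, mul_comm]
        gcongr
        exact hKB _
    _ = _ := integral_const_mul _ _

/-- Were the second derivative positive, the point would be a local minimum as well, so `f` would be
locally constant and its second derivative zero. -/
theorem deriv_deriv_nonpos_of_isLocalMax {f : ℝ → ℝ} {s : ℝ} (hf : Continuous f)
    (h : IsLocalMax f s) : deriv (deriv f) s ≤ 0 := by
  by_contra! hpos
  have hmin := isLocalMin_of_deriv_deriv_pos hpos h.deriv_eq_zero hf.continuousAt
  have hconst : f =ᶠ[𝓝 s] fun _ => f s := by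
    filter_upwards [h, hmin] with x h1 h2 using le_antisymm h1 h2
  have := hconst.deriv.deriv_eq
  simp at this
  linarith

/-- The maximum principle for the heat equation on a circle. -/
theorem heat_nonpos {ℓ : ℝ} (hℓ : 0 < ℓ) {T : ℝ} {u : ℝ → ℝ → ℝ}
    (hc : ContinuousOn (fun q : ℝ × ℝ => u q.1 q.2) (Icc 0 T ×ˢ univ))
    (hcs : ∀ t ∈ Icc 0 T, Continuous (u t))
    (hper : ∀ t ∈ Icc 0 T, Function.Periodic (u t) ℓ) (h0 : ∀ s, u 0 s ≤ 0)
    (hu : ∀ t ∈ Icc 0 T, ∀ s,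
      HasDerivWithinAt (fun t => u t s) (deriv (deriv (u t)) s) (Icc 0 T) t) :
    ∀ t ∈ Icc 0 T, ∀ s, u t s ≤ 0 := by
  intro t₁ ht₁ s₁
  by_contra! hpos
  obtain ⟨s₂, hs₂, he⟩ := (hper t₁ ht₁).exists_mem_Ico₀ hℓ s₁
  -- Subtracting `ε t` makes the differential inequality strict, while `u - ε t` is still positive
  -- at `(t₁, s₁)`.
  obtain ⟨ε, hε, hε'⟩ : ∃ ε > 0, ε * t₁ < u t₁ s₁ := by
    refine ⟨u t₁ s₁ / (t₁ + 1), div_pos hpos (by linarith [ht₁.1]), ?_⟩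
    rw [div_mul_eq_mul_div, div_lt_iff₀ (by linarith [ht₁.1])]
    nlinarith
  have hcw : ContinuousOn (fun q : ℝ × ℝ => u q.1 q.2 - ε * q.1) (Icc 0 T ×ˢ Icc 0 ℓ) :=
    (hc.mono (prod_mono_right (subset_univ _))).sub (by fun_prop)
  obtain ⟨⟨t, s⟩, ⟨ht, hs⟩, hmax⟩ := (isCompact_Icc.prod isCompact_Icc).exists_isMaxOn
    ⟨(t₁, s₂), ht₁, hs₂.1, hs₂.2.le⟩ hcw
  have hmax' : ∀ t' ∈ Icc 0 T, ∀ s', u t' s' - ε * t' ≤ u t s - ε * t := fun t' ht' s' => by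
    obtain ⟨s'', hs'', he'⟩ := (hper t' ht').exists_mem_Ico₀ hℓ s'
    rw [he']
    exact hmax (show (t', s'') ∈ _ from ⟨ht', hs''.1, hs''.2.le⟩)
  have htpos : 0 < t := by
    rcases ht.1.eq_or_lt with h | h
    · have h1 := hmax' t₁ ht₁ s₁
      have h2 := h0 s
      simp only at h
      rw [← h] at h1
      linarith
    · exact h
  have h2 : deriv (deriv (u t)) s ≤ 0 :=
    deriv_deriv_nonpos_of_isLocalMax (hcs t ht)
      (Eventually.of_forall fun s' => by linarith [hmax' t ht s'])
  have h3 : HasDerivWithinAt (fun t => u t s - ε * t) (deriv (deriv (u t)) s - ε) (Icc 0 T) t := by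
    exact ((hu t ht s).sub ((hasDerivWithinAt_id t _).const_mul ε)).congr_deriv (by simp)
  have h4 : IsLocalMaxOn (fun t => u t s - ε * t) (Icc 0 T) t := by
    filter_upwards [self_mem_nhdsWithin] with t' ht' using hmax' t' ht' s
  -- The maximum may lie at the final time `T`, so only the direction towards `0` is used. It gives
  -- time derivative at least `0` for `u - ε t`, whereas the equation gives at most `-ε`.
  have h5 := h4.hasFDerivWithinAt_nonpos h3.hasFDerivWithinAt (y := 0 - t)
    (sub_mem_posTangentConeAt_of_segment_subset
      ((convex_Icc 0 T).segment_subset ht ⟨le_rfl, ht.1.trans ht.2⟩))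
  simp at h5
  nlinarith

/-- By linearity, the maximum principle applies to `u - v` and to `v - u`. -/
theorem heat_unique {ℓ : ℝ} (hℓ : 0 < ℓ) {T : ℝ} {u v : ℝ → ℝ → ℝ}
    (hcu : ContinuousOn (fun q : ℝ × ℝ => u q.1 q.2) (Icc 0 T ×ˢ univ))
    (hcv : ContinuousOn (fun q : ℝ × ℝ => v q.1 q.2) (Icc 0 T ×ˢ univ))
    (hsu : ∀ t ∈ Icc 0 T, ContDiff ℝ ∞ (u t)) (hsv : ∀ t ∈ Icc 0 T, ContDiff ℝ ∞ (v t))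
    (hpu : ∀ t ∈ Icc 0 T, Function.Periodic (u t) ℓ)
    (hpv : ∀ t ∈ Icc 0 T, Function.Periodic (v t) ℓ) (h0 : u 0 = v 0)
    (hu : ∀ t ∈ Icc 0 T, ∀ s,
      HasDerivWithinAt (fun t => u t s) (deriv (deriv (u t)) s) (Icc 0 T) t)
    (hv : ∀ t ∈ Icc 0 T, ∀ s,
      HasDerivWithinAt (fun t => v t s) (deriv (deriv (v t)) s) (Icc 0 T) t) :
    ∀ t ∈ Icc 0 T, u t = v t := by
  have key : ∀ {u v : ℝ → ℝ → ℝ}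
      (_ : ContinuousOn (fun q : ℝ × ℝ => u q.1 q.2) (Icc 0 T ×ˢ univ))
      (_ : ContinuousOn (fun q : ℝ × ℝ => v q.1 q.2) (Icc 0 T ×ˢ univ))
      (_ : ∀ t ∈ Icc 0 T, ContDiff ℝ ∞ (u t)) (_ : ∀ t ∈ Icc 0 T, ContDiff ℝ ∞ (v t))
      (_ : ∀ t ∈ Icc 0 T, Function.Periodic (u t) ℓ)
      (_ : ∀ t ∈ Icc 0 T, Function.Periodic (v t) ℓ) (_ : u 0 = v 0)
      (_ : ∀ t ∈ Icc 0 T, ∀ s,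
        HasDerivWithinAt (fun t => u t s) (deriv (deriv (u t)) s) (Icc 0 T) t)
      (_ : ∀ t ∈ Icc 0 T, ∀ s,
        HasDerivWithinAt (fun t => v t s) (deriv (deriv (v t)) s) (Icc 0 T) t),
      ∀ t ∈ Icc 0 T, ∀ s, u t s - v t s ≤ 0 := by
    intro u v hcu hcv hsu hsv hpu hpv h0 hu hv
    refine heat_nonpos hℓ (u := fun t s => u t s - v t s) (hcu.sub hcv)
      (fun t ht => ((hsu t ht).continuous.sub (hsv t ht).continuous))
      (fun t ht s => by simp [hpu t ht s, hpv t ht s]) (fun s => by simp [h0]) fun t ht s => ?_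
    have e1 : deriv (fun s => u t s - v t s) = fun s => deriv (u t) s - deriv (v t) s := by
      ext s
      exact deriv_fun_sub ((hsu t ht).differentiable (by simp) s)
        ((hsv t ht).differentiable (by simp) s)
    have e2 : deriv (deriv fun s => u t s - v t s) s =
        deriv (deriv (u t)) s - deriv (deriv (v t)) s := by
      rw [e1]
      exact deriv_fun_sub
        (((contDiff_infty_iff_deriv.1 (hsu t ht)).2).differentiable (by simp) s)
        (((contDiff_infty_iff_deriv.1 (hsv t ht)).2).differentiable (by simp) s)
    rw [e2]
    exact (hu t ht s).sub (hv t ht s)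
  intro t ht
  ext s
  exact le_antisymm (sub_nonpos.1 (key hcu hcv hsu hsv hpu hpv h0 hu hv t ht s))
    (sub_nonpos.1 (key hcv hcu hsv hsu hpv hpu h0.symm hv hu t ht s))

end Periodic

/-! ### Parametrization of the circle by an integral curve of `N`. -/

section CircleCurve

/-- The flow of a positive periodic field on the line: `A` is the travel time from `0` and `Θ` the
position. -/
theorem exists_flow_of_pos {a : ℝ → ℝ} (ha : ContDiff ℝ ∞ a) (hpos : ∀ θ, 0 < a θ) {T : ℝ}
    (hT : 0 < T) (hper : Function.Periodic a T) :
    ∃ (A Θ : ℝ → ℝ) (ℓ : ℝ), 0 < ℓ ∧ ContDiff ℝ ∞ A ∧ ContDiff ℝ ∞ Θ ∧ (∀ θ, Θ (A θ) = θ) ∧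
      (∀ s, A (Θ s) = s) ∧ (∀ s, HasDerivAt Θ (a (Θ s)) s) ∧ (∀ θ, HasDerivAt A (a θ)⁻¹ θ) ∧
      A 0 = 0 ∧ A T = ℓ ∧ ∀ θ, A (θ + T) = A θ + ℓ := by
  have hai : ContDiff ℝ ∞ fun θ => (a θ)⁻¹ := ha.inv fun θ => (hpos θ).ne'
  have hci := hai.continuous
  let A : ℝ → ℝ := fun θ => ∫ v in (0 : ℝ)..θ, (a v)⁻¹
  have hA : ∀ θ, HasDerivAt A (a θ)⁻¹ θ := fun θ =>
    intervalIntegral.integral_hasDerivAt_right (hci.intervalIntegrable _ _)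
      (hci.stronglyMeasurableAtFilter _ _) hci.continuousAt
  have hAs : ContDiff ℝ ∞ A := contDiff_infty_iff_deriv.2
    ⟨fun θ => (hA θ).differentiableAt, by
      rw [show deriv A = fun θ => (a θ)⁻¹ from funext fun θ => (hA θ).deriv]; exact hai⟩
  have hA0 : A 0 = 0 := by simp [A]
  have hmono : StrictMono A := strictMono_of_deriv_pos fun θ => by
    rw [(hA θ).deriv]; exact inv_pos.2 (hpos θ)
  have hℓ : 0 < A T := hA0 ▸ hmono hT
  have hAT : ∀ θ, A (θ + T) = A θ + A T := fun θ => by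
    have h1 : A (θ + T) = A θ + ∫ v in θ..θ + T, (a v)⁻¹ :=
      (intervalIntegral.integral_add_adjacent_intervals (hci.intervalIntegrable _ _)
        (hci.intervalIntegrable _ _)).symm
    have hp : Function.Periodic (fun v => (a v)⁻¹) T := fun v => by simp [hper v]
    rw [h1, hp.intervalIntegral_add_eq θ 0, zero_add]
  have hAn : ∀ n : ℕ, A (n * T) = n * A T := fun n => by
    induction n with
    | zero => simp [hA0]
    | succ n ih => rw [Nat.cast_succ, add_mul, one_mul, hAT, ih]; ring
  have hAn' : ∀ n : ℕ, A (-(n * T)) = -(n * A T) := fun n => by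
    induction n with
    | zero => simp [hA0]
    | succ n ih =>
      have := hAT (-((n + 1 : ℕ) * T))
      rw [show -((n + 1 : ℕ) * T) + T = -(n * T) by push_cast; ring, ih] at this
      push_cast at this ⊢
      linarith
  -- `A` is unbounded in both directions because `A (n T) = n A(T)` for every integer `n`.
  have hsurj : Function.Surjective A := by
    refine hAs.continuous.surjective
      (tendsto_atTop_mono' atTop EventuallyEq.rfl.le ?_) ?_
    · refine tendsto_atTop_atTop_of_monotone hmono.monotone fun b => ?_
      obtain ⟨n, hn⟩ := exists_nat_ge (b / A T)
      exact ⟨n * T, by rw [hAn]; exact (div_le_iff₀ hℓ).1 hn⟩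
    · refine tendsto_atBot_atBot_of_monotone hmono.monotone fun b => ?_
      obtain ⟨n, hn⟩ := exists_nat_ge (-b / A T)
      exact ⟨-(n * T), by rw [hAn']; linarith [(div_le_iff₀ hℓ).1 hn]⟩
  let e : ℝ ≃o ℝ := hmono.orderIsoOfSurjective A hsurj
  have he : ∀ θ, e θ = A θ := fun θ => rfl
  let h : ℝ ≃ₜ ℝ := e.toHomeomorph
  have hΘ : ContDiff ℝ ∞ h.symm :=
    h.contDiff_symm_deriv (f' := fun θ => (a θ)⁻¹) (fun θ => inv_ne_zero (hpos θ).ne') hA hAs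
  have h1 : ∀ θ, h.symm (A θ) = θ := h.symm_apply_apply
  have h2 : ∀ s, A (h.symm s) = s := h.apply_symm_apply
  refine ⟨A, h.symm, A T, hℓ, hAs, hΘ, h1, h2, fun s => ?_, hA, hA0, rfl, hAT⟩
  have := HasDerivAt.of_local_left_inverse (f := A) (g := h.symm) (a := s)
    hΘ.continuous.continuousAt (hA (h.symm s)) (inv_ne_zero (hpos _).ne')
    (Eventually.of_forall h2)
  rwa [inv_inv] at this

/-- `γ` parametrizes the circle as an integral curve of `N` of period `ℓ`, and the mean over the
circle for the arc length of `g₂` is the mean in the parameter of `γ`. -/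
structure IsUnitParam (g₂ : Metric (𝓡 1) Circle) (N : VField (𝓡 1) Circle) (γ : ℝ → Circle)
    (ℓ : ℝ) : Prop where
  pos : 0 < ℓ
  smooth : ContMDiff 𝓘(ℝ, ℝ) (𝓡 1) ∞ γ
  mfderiv_one : ∀ s, mfderiv 𝓘(ℝ, ℝ) (𝓡 1) γ s (1 : ℝ) = N (γ s)
  surjective : Function.Surjective γ
  eq_iff : ∀ s s', γ s = γ s' ↔ ∃ m : ℤ, s' = s + m * ℓ
  exists_section : ∀ s₀, ∃ σ : Circle → ℝ, ContMDiffAt (𝓡 1) 𝓘(ℝ, ℝ) ∞ σ (γ s₀) ∧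
    ∀ᶠ y in 𝓝 (γ s₀), γ (σ y) = y
  mean : ∀ h : Circle → ℝ, Continuous h →
    circleMean g₂ h = (∫ s in (0 : ℝ)..ℓ, h (γ s)) / ℓ

/-- The velocity of the parametrization `θ ↦ exp(iθ)`. -/
def expVelocity (θ : ℝ) : TangentSpace (𝓡 1) (Circle.exp θ) :=
  mfderiv 𝓘(ℝ, ℝ) (𝓡 1) (fun s : ℝ => Circle.exp s) θ (1 : ℝ)

theorem contMDiff_circle_coe : ContMDiff (𝓡 1) 𝓘(ℝ, ℂ) ∞ (fun y : Circle => (y : ℂ)) :=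
  haveI : Fact (Module.finrank ℝ ℂ = 1 + 1) := finrank_real_complex_fact'
  contMDiff_coe_sphere

/-- The embedding in `ℂ` makes tangent vectors explicit: it shows that the velocity is nonzero and
lets the coefficient of `N` be read off as a smooth function. -/
theorem mfderiv_coe_expVelocity (θ : ℝ) :
    mfderiv (𝓡 1) 𝓘(ℝ, ℂ) (fun y : Circle => (y : ℂ)) (Circle.exp θ) (expVelocity θ) =
      (Complex.I * (Circle.exp θ : ℂ) : ℂ) := by
  have h1 : MDifferentiableAt 𝓘(ℝ, ℝ) (𝓡 1) (fun s : ℝ => Circle.exp s) θ :=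
    (contMDiff_circleExp (m := 1)).mdifferentiableAt one_ne_zero
  have h2 : MDifferentiableAt (𝓡 1) 𝓘(ℝ, ℂ) (fun y : Circle => (y : ℂ)) (Circle.exp θ) :=
    contMDiff_circle_coe.mdifferentiableAt (by simp)
  have h3 := mfderiv_comp_apply θ h2 h1 (1 : ℝ)
  refine Eq.trans (Eq.symm h3) ?_
  rw [mfderiv_eq_fderiv]
  have h4 : HasDerivAt (fun s : ℝ => Complex.exp (s * Complex.I))
      (Complex.exp (θ * Complex.I) * Complex.I) θ := by
    have h := ((Complex.ofRealCLM.hasDerivAt (x := θ)).mul_const Complex.I).cexp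
    simpa using h
  have h5 : ((fun y : Circle => (y : ℂ)) ∘ fun s : ℝ => Circle.exp s) =
      fun s : ℝ => Complex.exp (s * Complex.I) := by
    ext s; simp
  rw [h5]
  rw [h4.hasFDerivAt.fderiv]
  exact (one_smul ℝ _).trans (mul_comm (Complex.exp (θ * Complex.I)) Complex.I)

theorem exists_eq_smul_expVelocity (θ : ℝ) (v : TangentSpace (𝓡 1) (Circle.exp θ)) :
    ∃ c : ℝ, v = c • expVelocity θ := by
  have hne : expVelocity θ ≠ 0 := fun h => by
    have := mfderiv_coe_expVelocity θ
    rw [h, map_zero] at this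
    exact (mul_ne_zero Complex.I_ne_zero (Circle.coe_ne_zero _)) this.symm
  have hr : Module.finrank ℝ (TangentSpace (𝓡 1) (Circle.exp θ)) = 1 := by
    change Module.finrank ℝ (EuclideanSpace ℝ (Fin 1)) = 1
    simp
  obtain ⟨c, hc⟩ := (finrank_eq_one_iff_of_nonzero' (expVelocity θ) hne).1 hr v
  exact ⟨c, hc.symm⟩

theorem circleSpeed_sq (g₂ : Metric (𝓡 1) Circle) (θ : ℝ) :
    circleSpeed g₂ θ = √(g₂.inner (Circle.exp θ) (expVelocity θ) (expVelocity θ)) := rfl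

/-- The coefficient of a smooth field of unit length with respect to the angular coordinate. -/
theorem exists_angular_coefficient (g₂ : Metric (𝓡 1) Circle) {N : VField (𝓡 1) Circle}
    (hN : IsSmoothField (𝓡 1) N) (hN_unit : ∀ y, g₂.inner y (N y) (N y) = 1) :
    ∃ a : ℝ → ℝ, ContDiff ℝ ∞ a ∧ Function.Periodic a (2 * Real.pi) ∧
      (∀ θ, N (Circle.exp θ) = a θ • expVelocity θ) ∧ ∀ θ, |a θ| * circleSpeed g₂ θ = 1 := by
  let β : Circle → ℂ := fun y => mfderiv (𝓡 1) 𝓘(ℝ, ℂ) (fun y : Circle => (y : ℂ)) y (N y)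
  -- A tangent vector at `y` has image `c i y` in `ℂ`; multiplying by the conjugate of `y` leaves `c
  -- i`, whose imaginary part is the coefficient `c`.
  let α : Circle → ℝ := fun y => ((starRingEnd ℂ) (y : ℂ) * β y).im
  have hα : ContMDiff (𝓡 1) 𝓘(ℝ, ℝ) ∞ α := by
    have h1 : ContMDiff (𝓡 1) 𝓘(ℝ, ℂ) ∞ β := by
      have h := (contMDiff_circle_coe.contMDiff_tangentMap (m := ∞) (by simp)).comp hN
      exact contMDiff_snd_tangentBundle_modelSpace ℂ 𝓘(ℝ, ℂ) |>.comp h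
    have h2 : ContDiff ℝ ∞ (fun p : ℂ × ℂ => (Complex.conjCLE p.1 * p.2).im) :=
      Complex.imCLM.contDiff.comp
        ((Complex.conjCLE.contDiff.comp contDiff_fst).mul contDiff_snd)
    exact h2.contMDiff.comp (contMDiff_circle_coe.prodMk_space h1)
  have key : ∀ θ, N (Circle.exp θ) = α (Circle.exp θ) • expVelocity θ := fun θ => by
    obtain ⟨c, hc⟩ := exists_eq_smul_expVelocity θ (N (Circle.exp θ))
    have : α (Circle.exp θ) = c := by
      have hβ : β (Circle.exp θ) = c • (Complex.I * (Circle.exp θ : ℂ)) := by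
        simp only [β]
        rw [hc, map_smul, mfderiv_coe_expVelocity]
        rfl
      simp only [α]
      rw [hβ]
      have h1 : (starRingEnd ℂ) (Circle.exp θ : ℂ) * (Circle.exp θ : ℂ) = 1 := by
        rw [mul_comm, Complex.mul_conj, Circle.normSq_coe]; simp
      have h2 : (starRingEnd ℂ) (Circle.exp θ : ℂ) * (c • (Complex.I * (Circle.exp θ : ℂ)) : ℂ) =
          c * Complex.I := by
        rw [Complex.real_smul]
        linear_combination (c * Complex.I) * h1
      exact (congrArg Complex.im h2).trans (by simp)
    rw [this, hc]
  refine ⟨fun θ => α (Circle.exp θ), ?_, fun θ => by simp [Circle.exp_add], key, fun θ => ?_⟩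
  · exact contMDiff_iff_contDiff.1 (hα.comp contMDiff_circleExp)
  · have h := hN_unit (Circle.exp θ)
    rw [key θ] at h
    simp only [map_smul, smul_eq_mul, smul_apply] at h
    rw [circleSpeed_sq, ← Real.sqrt_sq_eq_abs, ← Real.sqrt_mul (sq_nonneg _)]
    rw [show α (Circle.exp θ) ^ 2 * (g₂.inner (Circle.exp θ)) (expVelocity θ) (expVelocity θ) = 1
      by rw [← h]; ring]
    simp

/-- Serves both orientations of `N`. The periodicity hypotheses leave the integer `k` free, because
it is `m` or `-m` according to the sign of `a`. -/
theorem isUnitParam_of_flow {g₂ : Metric (𝓡 1) Circle} {N : VField (𝓡 1) Circle} {a A Θ : ℝ → ℝ}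
    {ℓ : ℝ} (hℓ : 0 < ℓ) (hA : ContDiff ℝ ∞ A) (hΘ : ContDiff ℝ ∞ Θ) (hΘA : ∀ θ, Θ (A θ) = θ)
    (hAΘ : ∀ s, A (Θ s) = s) (hΘ' : ∀ s, HasDerivAt Θ (a (Θ s)) s)
    (hper : ∀ (θ : ℝ) (m : ℤ), ∃ k : ℤ, A (θ + m * (2 * Real.pi)) = A θ + k * ℓ)
    (hper' : ∀ (s : ℝ) (m : ℤ), ∃ k : ℤ, Θ (s + m * ℓ) = Θ s + k * (2 * Real.pi))
    (hN : ∀ θ, N (Circle.exp θ) = a θ • expVelocity θ)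
    (hmean : ∀ h : Circle → ℝ, Continuous h →
      circleIntegral g₂ h = ∫ s in (0 : ℝ)..ℓ, h (Circle.exp (Θ s))) :
    IsUnitParam g₂ N (fun s => Circle.exp (Θ s)) ℓ where
  pos := hℓ
  smooth := contMDiff_circleExp.comp hΘ.contMDiff
  mfderiv_one s := by
    have h1 : MDifferentiableAt 𝓘(ℝ, ℝ) (𝓡 1) (fun s : ℝ => Circle.exp s) (Θ s) :=
      (contMDiff_circleExp (m := 1)).mdifferentiableAt one_ne_zero
    have h2 : MDifferentiableAt 𝓘(ℝ, ℝ) 𝓘(ℝ, ℝ) Θ s := (hΘ' s).differentiableAt.mdifferentiableAt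
    refine (mfderiv_comp_apply s h1 h2 (1 : ℝ)).trans ?_
    have h3 : mfderiv 𝓘(ℝ, ℝ) 𝓘(ℝ, ℝ) Θ s (1 : ℝ) = a (Θ s) • (1 : ℝ) := by
      rw [mfderiv_eq_fderiv]
      rw [(hΘ' s).hasFDerivAt.fderiv]
      exact (one_smul ℝ _).trans (mul_one (a (Θ s))).symm
    rw [h3, hN]
    exact map_smul _ _ _
  surjective y := by
    obtain ⟨θ, hθ⟩ := Circle.exp_surjective y
    exact ⟨A θ, by simp [hΘA, hθ]⟩
  eq_iff s s' := by
    rw [Circle.exp_eq_exp]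
    constructor
    · rintro ⟨m, hm⟩
      obtain ⟨k, hk⟩ := hper (Θ s') m
      rw [← hm, hAΘ, hAΘ] at hk
      exact ⟨-k, by push_cast; linarith⟩
    · rintro ⟨m, rfl⟩
      obtain ⟨k, hk⟩ := hper' s m
      exact ⟨-k, by rw [hk]; push_cast; ring⟩
  exists_section s₀ := by
    -- Rotating `γ s₀` to `1` moves the branch cut of the argument away from the point.
    refine ⟨fun y => A (Θ s₀ + Complex.arg ((y : ℂ) * (Circle.exp (-Θ s₀) : ℂ))), ?_,
      Eventually.of_forall fun y => ?_⟩
    · have h1 : (Circle.exp (Θ s₀) : ℂ) * (Circle.exp (-Θ s₀) : ℂ) = 1 := by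
        rw [← Circle.coe_mul, ← Circle.exp_add]; simp
      have h2 : ContDiffAt ℝ ∞ Complex.arg
          ((Circle.exp (Θ s₀) : ℂ) * (Circle.exp (-Θ s₀) : ℂ)) := by
        have h : ContDiffAt ℝ ∞ (fun z : ℂ => (Complex.log z).im) 1 :=
          Complex.imCLM.contDiff.contDiffAt.comp _
            ((Complex.contDiffAt_log (n := ∞) Complex.one_mem_slitPlane).restrict_scalars ℝ)
        rw [h1]
        exact h.congr_of_eventuallyEq (Eventually.of_forall fun z => (Complex.log_im z).symm)
      have h3 : ContDiffAt ℝ ∞ (fun z : ℂ => A (Θ s₀ + Complex.arg (z * (Circle.exp (-Θ s₀) : ℂ))))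
          (Circle.exp (Θ s₀) : ℂ) := by
        refine hA.contDiffAt.comp _ (contDiffAt_const.add ?_)
        exact ContDiffAt.comp (f := fun z : ℂ => z * (Circle.exp (-Θ s₀) : ℂ)) _ h2
          (contDiffAt_id.mul contDiffAt_const)
      exact h3.contMDiffAt.comp (Circle.exp (Θ s₀)) (contMDiff_circle_coe _)
    · simp only [hΘA, Circle.exp_add]
      rw [← Circle.coe_mul, Circle.exp_arg, mul_comm, mul_assoc, ← Circle.exp_add]
      simp
  mean h hh := by
    rw [circleMean, hmean h hh, hmean _ continuous_const]
    simp

theorem exists_isUnitParam (g₂ : Metric (𝓡 1) Circle) {N : VField (𝓡 1) Circle}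
    (hN : IsSmoothField (𝓡 1) N) (hN_unit : ∀ y, g₂.inner y (N y) (N y) = 1) :
    ∃ (γ : ℝ → Circle) (ℓ : ℝ), IsUnitParam g₂ N γ ℓ := by
  obtain ⟨a, ha, hper, haN, has⟩ := exists_angular_coefficient g₂ hN hN_unit
  have ha0 : ∀ θ, a θ ≠ 0 := fun θ h => by
    have := has θ
    simp [h] at this
  have hspeed : ∀ θ, circleSpeed g₂ θ = |a θ|⁻¹ := fun θ => by
    rw [eq_inv_of_mul_eq_one_right (has θ)]
  -- `N` has unit length, so `a` has no zero, and by the intermediate value theorem it has constant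
  -- sign.
  have hsign : (∀ θ, 0 < a θ) ∨ ∀ θ, 0 < -a θ := by
    by_contra! hcon
    obtain ⟨⟨θ₁, h1⟩, θ₂, h2⟩ := hcon
    obtain ⟨θ, hθ⟩ := mem_range_of_exists_le_of_exists_ge ha.continuous ⟨θ₁, h1⟩
      ⟨θ₂, neg_nonpos.1 h2⟩
    exact ha0 θ hθ
  have hAm : ∀ {A : ℝ → ℝ} {ℓ : ℝ}, (∀ θ, A (θ + 2 * Real.pi) = A θ + ℓ) →
      ∀ (m : ℤ) (θ : ℝ), A (θ + m * (2 * Real.pi)) = A θ + m * ℓ := by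
    intro A ℓ h m
    induction m with
    | zero => simp
    | succ n ih =>
      intro θ
      have := h (θ + n * (2 * Real.pi))
      push_cast at ih ⊢
      rw [add_mul, one_mul, ← add_assoc, this, ih]; ring
    | pred n ih =>
      intro θ
      have := h (θ + (-n - 1) * (2 * Real.pi))
      rw [show θ + (-n - 1) * (2 * Real.pi) + 2 * Real.pi = θ + -n * (2 * Real.pi) by ring] at this
      push_cast at ih ⊢
      rw [ih] at this
      linarith
  have hΘm : ∀ {A Θ : ℝ → ℝ} {ℓ : ℝ}, (∀ θ, A (θ + 2 * Real.pi) = A θ + ℓ) →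
      (∀ θ, Θ (A θ) = θ) → (∀ s, A (Θ s) = s) → ∀ (m : ℤ) (s : ℝ),
      Θ (s + m * ℓ) = Θ s + m * (2 * Real.pi) := by
    intro A Θ ℓ h h1 h2 m s
    have := hAm h m (Θ s)
    rw [h2] at this
    rw [← this, h1]
  -- The substitution `s = A θ` has derivative `1 / |a|`, which is the `g₂`-speed of `exp(iθ)`; so
  -- `s` is an arc length parameter.
  have hint : ∀ {b A Θ : ℝ → ℝ} {ℓ : ℝ}, Continuous b → (∀ θ, 0 < b θ) → Continuous Θ →
      (∀ θ, HasDerivAt A (b θ)⁻¹ θ) → (∀ θ, Θ (A θ) = θ) → A 0 = 0 → A (2 * Real.pi) = ℓ →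
      (∀ θ, |a θ| = b θ) → ∀ h : Circle → ℝ, Continuous h →
      circleIntegral g₂ h = ∫ s in (0 : ℝ)..ℓ, h (Circle.exp (Θ s)) := by
    intro b A Θ ℓ hb hb0 hΘ hA hΘA h0 hℓ hab h hh
    have h1 := intervalIntegral.integral_comp_mul_deriv (a := 0) (b := 2 * Real.pi)
      (f := A) (f' := fun θ => (b θ)⁻¹) (g := fun s => h (Circle.exp (Θ s)))
      (fun θ _ => hA θ) (hb.inv₀ fun θ => (hb0 θ).ne').continuousOn
      (hh.comp (Circle.exp.continuous.comp hΘ))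
    rw [h0, hℓ] at h1
    rw [← h1, circleIntegral]
    refine intervalIntegral.integral_congr fun θ _ => ?_
    simp [hspeed, hab, hΘA]
  rcases hsign with hpos | hneg
  · obtain ⟨A, Θ, ℓ, hℓ, hA, hΘ, h1, h2, h3, h4, h5, h6, h7⟩ :=
      exists_flow_of_pos ha hpos Real.two_pi_pos hper
    exact ⟨_, ℓ, isUnitParam_of_flow hℓ hA hΘ h1 h2 h3 (fun θ m => ⟨m, hAm h7 m θ⟩)
      (fun s m => ⟨m, hΘm h7 h1 h2 m s⟩) haN
      (hint ha.continuous hpos hΘ.continuous h4 h1 h5 h6 fun θ => abs_of_pos (hpos θ))⟩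
  -- For negative `a` the flow of `-a` is run backwards: `s ↦ Θ (-s)`.
  · obtain ⟨A, Θ, ℓ, hℓ, hA, hΘ, h1, h2, h3, h4, h5, h6, h7⟩ :=
      exists_flow_of_pos (a := fun θ => -a θ) ha.neg hneg Real.two_pi_pos fun θ => by simp [hper θ]
    refine ⟨_, ℓ, isUnitParam_of_flow (A := fun θ => -A θ) (Θ := fun s => Θ (-s)) hℓ hA.neg
      (hΘ.comp contDiff_neg) (fun θ => by simp [h1]) (fun s => by simp [h2]) (fun s => ?_)
      (fun θ m => ⟨-m, ?_⟩) (fun s m => ⟨-m, ?_⟩) haN fun h hh => ?_⟩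
    · exact ((h3 (-s)).comp s (hasDerivAt_neg s)).congr_deriv (by simp)
    · rw [hAm h7 m θ]; push_cast; ring
    · have := hΘm h7 h1 h2 (-m) (-s)
      rw [← this]
      congr 1; push_cast; ring
    -- Reversal turns the integral over `[0, ℓ]` into one over `[-ℓ, 0]`; periodicity moves it back.
    · have hp : Function.Periodic (fun s => h (Circle.exp (Θ s))) ℓ := fun s => by
        have := hΘm h7 h1 h2 1 s
        simp only [Int.cast_one, one_mul] at this
        simp [this, Circle.exp_add]
      rw [hint ha.continuous.neg hneg hΘ.continuous h4 h1 h5 h6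
        (fun θ => abs_of_neg (neg_pos.1 (hneg θ))) h hh]
      rw [intervalIntegral.integral_comp_neg (fun s => h (Circle.exp (Θ s)))]
      have := hp.intervalIntegral_add_eq (-ℓ) 0
      simpa using this.symm

end CircleCurve

/-! ### Smooth vector fields and the action of the Lie bracket on functions. -/

section Fields

variable {E : Type*} [NormedAddCommGroup E] [NormedSpace ℝ E]
  {H : Type*} [TopologicalSpace H] {I : ModelWithCorners ℝ E H}
  {M : Type*} [TopologicalSpace M] [ChartedSpace H M] [IsManifold I ∞ M]

theorem two_le_infty : (2 : ℕ∞ω) ≤ ∞ :=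
  WithTop.coe_le_coe.2 (le_top : (2 : ℕ∞) ≤ ⊤)

theorem IsSmoothField.mdifferentiableAt {X : VField I M} (hX : IsSmoothField I X) (p : M) :
    MDifferentiableAt I I.tangent (fun p => (⟨p, X p⟩ : TangentBundle I M)) p :=
  ContMDiff.mdifferentiableAt hX (by simp)

theorem IsSmoothField.mlieBracket [CompleteSpace E] {X Y : VField I M} (hX : IsSmoothField I X)
    (hY : IsSmoothField I Y) : IsSmoothField I (VectorField.mlieBracket I X Y) := by
  have : IsManifold I (minSmoothness ℝ 2) M := by
    rw [minSmoothness_of_isRCLikeNormedField]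
    exact IsManifold.of_le (n := ∞) two_le_infty
  have : IsManifold I (((⊤ : ℕ∞) : ℕ∞ω) + 1) M := by simpa using ‹IsManifold I ∞ M›
  exact ContDiff.mlieBracket_vectorField (m := ⊤) (n := ⊤) hX hY (by simp)

theorem contMDiff_dirDeriv {X : VField I M} (hX : IsSmoothField I X) {h : M → ℝ}
    (hh : ContMDiff I 𝓘(ℝ, ℝ) ∞ h) : ContMDiff I 𝓘(ℝ, ℝ) ∞ (dirDeriv X h) := by
  have h1 := (hh.contMDiff_tangentMap (m := ∞) (by simp)).comp hX
  exact contMDiff_snd_tangentBundle_modelSpace ℝ 𝓘(ℝ, ℝ) |>.comp h1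

theorem IsSmoothField.smul {X : VField I M} (hX : IsSmoothField I X) {h : M → ℝ}
    (hh : ContMDiff I 𝓘(ℝ, ℝ) ∞ h) : IsSmoothField I (h • X) :=
  ContMDiff.smul_section hh hX

theorem IsSmoothField.sub {X Y : VField I M} (hX : IsSmoothField I X) (hY : IsSmoothField I Y) :
    IsSmoothField I (X - Y) :=
  ContMDiff.sub_section hX hY

/-- The Lie bracket of two fields acts on functions as their commutator. The field `W` is any
smooth field that does not vanish at the point. -/
theorem dirDeriv_mlieBracket [CompleteSpace E] {X Y W : VField I M} (hX : IsSmoothField I X)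
    (hY : IsSmoothField I Y) (hW : IsSmoothField I W) {h : M → ℝ} (hh : ContMDiff I 𝓘(ℝ, ℝ) ∞ h)
    {p : M} (hp : W p ≠ 0) :
    dirDeriv (VectorField.mlieBracket I X Y) h p =
      dirDeriv X (dirDeriv Y h) p - dirDeriv Y (dirDeriv X h) p := by
  have : IsManifold I 2 M := IsManifold.of_le (n := ∞) two_le_infty
  have : IsManifold I (minSmoothness ℝ 3) M := by
    rw [minSmoothness_of_isRCLikeNormedField]
    exact IsManifold.of_le (n := ∞) (WithTop.coe_le_coe.2 (le_top : (3 : ℕ∞) ≤ ⊤))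
  -- The commutator formula is extracted from the Jacobi identity for `X`, `Y` and `h • W`.
  have jac : ∀ {Z : VField I M}, IsSmoothField I Z →
      VectorField.mlieBracket I X (VectorField.mlieBracket I Y Z) p =
        VectorField.mlieBracket I (VectorField.mlieBracket I X Y) Z p +
          VectorField.mlieBracket I Y (VectorField.mlieBracket I X Z) p := fun {Z} hZ => by
    have hle : minSmoothness ℝ 2 ≤ (∞ : ℕ∞ω) := by
      rw [minSmoothness_of_isRCLikeNormedField]; exact two_le_infty
    exact VectorField.leibniz_identity_mlieBracket_apply ((hX p).of_le hle) ((hY p).of_le hle)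
      ((hZ p).of_le hle)
  have leib : ∀ {Z Z' : VField I M} {k : M → ℝ} (q : M), IsSmoothField I Z' →
      ContMDiff I 𝓘(ℝ, ℝ) ∞ k → VectorField.mlieBracket I Z (k • Z') q =
        dirDeriv Z k q • Z' q + k q • VectorField.mlieBracket I Z Z' q :=
    fun {Z Z' k} q hZ' hk => VectorField.mlieBracket_smul_right
      (hk.mdifferentiableAt (by simp)) (hZ'.mdifferentiableAt q)
  have two : ∀ {Z Z' : VField I M}, IsSmoothField I Z → IsSmoothField I Z' →
      VectorField.mlieBracket I Z (VectorField.mlieBracket I Z' (h • W)) p =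
        dirDeriv Z (dirDeriv Z' h) p • W p + dirDeriv Z' h p • VectorField.mlieBracket I Z W p +
        (dirDeriv Z h p • VectorField.mlieBracket I Z' W p +
          h p • VectorField.mlieBracket I Z (VectorField.mlieBracket I Z' W) p) := by
    intro Z Z' hZ hZ'
    have h1 : VectorField.mlieBracket I Z' (h • W) =
        dirDeriv Z' h • W + h • VectorField.mlieBracket I Z' W :=
      funext fun q => leib q hW hh
    have h2 := contMDiff_dirDeriv hZ' hh
    rw [h1, VectorField.mlieBracket_add_right ((hW.smul h2).mdifferentiableAt p)
      (((hZ'.mlieBracket hW).smul hh).mdifferentiableAt p), leib p hW h2,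
      leib p (hZ'.mlieBracket hW) hh]
  have key := jac (hW.smul hh)
  rw [two hX hY, two hY hX, leib p hW hh, jac hW] at key
  have : (dirDeriv (VectorField.mlieBracket I X Y) h p -
      (dirDeriv X (dirDeriv Y h) p - dirDeriv Y (dirDeriv X h) p)) • W p = 0 := by
    rw [← sub_eq_zero.2 key.symm]
    module
  rcases smul_eq_zero.1 this with h0 | h0
  · exact sub_eq_zero.1 h0
  · exact absurd h0 hp

end Fields

/-! ### Extending tangent vectors to fields, and testing them on functions. -/

section Extension

variable {E : Type*} [NormedAddCommGroup E] [NormedSpace ℝ E] [FiniteDimensional ℝ E]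
  {H : Type*} [TopologicalSpace H] {I : ModelWithCorners ℝ E H}
  {M : Type*} [TopologicalSpace M] [ChartedSpace H M] [IsManifold I ∞ M] [T2Space M]

/-- A local extension is cut off by a bump function. This lets the flow equation, stated for smooth
fields, be evaluated on single vectors. -/
theorem exists_isSmoothField_eq (p : M) (v : TangentSpace I p) :
    ∃ X : VField I M, IsSmoothField I X ∧ X p = v := by
  obtain ⟨s, hs, hX⟩ := FiberBundle.exists_contMDiffOn_extend (k := ∞) I E v
  obtain ⟨f, -, hf⟩ := (SmoothBumpFunction.nhds_basis_tsupport (I := I) p).mem_iff.1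
    (interior_mem_nhds.2 hs)
  refine ⟨fun q => f q • FiberBundle.extend E v q, ?_, ?_⟩
  · exact ContMDiffOn.smul_section_of_tsupport f.contMDiff.contMDiffOn isOpen_interior hf
      (hX.mono interior_subset)
  · simp

/-- Tangent vectors are determined by their action on smooth functions. -/
theorem eq_of_forall_mvfderiv_eq {p : M} {u w : TangentSpace I p}
    (h : ∀ k : M → ℝ, ContMDiff I 𝓘(ℝ, ℝ) ∞ k → mvfderiv I k p u = mvfderiv I k p w) : u = w := by
  obtain ⟨f⟩ : Nonempty (SmoothBumpFunction I p) := inferInstance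
  have hext : MDifferentiableAt I 𝓘(ℝ, E) (extChartAt I p) p :=
    (contMDiffAt_extChartAt (n := 1)).mdifferentiableAt one_ne_zero
  have key : mfderiv I 𝓘(ℝ, E) (extChartAt I p) p u = mfderiv I 𝓘(ℝ, E) (extChartAt I p) p w := by
    refine (SeparatingDual.eq_iff_forall_dual_eq (R := ℝ) (V := E)).2 fun φ => ?_
    -- The cut-off coordinate functions are globally smooth and agree near `p` with the coordinates
    -- of the chart, whose derivative at `p` is injective.
    have hk : ContMDiff I 𝓘(ℝ, ℝ) ∞ fun q => f q • φ (extChartAt I p q) :=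
      f.contMDiff_smul (φ.contDiff.contMDiff.comp_contMDiffOn
        (contMDiffOn_extChartAt (x := p)))
    have he : (fun q => f q • φ (extChartAt I p q)) =ᶠ[𝓝 p] φ ∘ extChartAt I p := by
      filter_upwards [f.eventuallyEq_one] with q hq
      simp [hq]
    have hd : ∀ v : TangentSpace I p, mvfderiv I (fun q => f q • φ (extChartAt I p q)) p v =
        φ (mfderiv I 𝓘(ℝ, E) (extChartAt I p) p v) := fun v => by
      have h1 : mfderiv I 𝓘(ℝ, ℝ) (fun q => f q • φ (extChartAt I p q)) p =
          mfderiv I 𝓘(ℝ, ℝ) (φ ∘ extChartAt I p) p := he.mfderiv_eq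
      have h2 := mfderiv_comp_apply p (φ.mdifferentiableAt (x := extChartAt I p p)) hext v
      rw [φ.mfderiv_eq] at h2
      exact (congrArg (fun A : TangentSpace I p →L[ℝ] ℝ => A v) h1).trans h2
    rw [← hd u, ← hd w]
    exact h _ hk
  have hinv := isInvertible_mfderiv_extChartAt (I := I) (mem_extChartAt_source p)
  exact hinv.injective key

end Extension

/-! ### Smoothness of families of bilinear forms, tested on frames. -/

section Bilinear

variable {E : Type*} [NormedAddCommGroup E] [NormedSpace ℝ E]
  {H : Type*} [TopologicalSpace H] {I : ModelWithCorners ℝ E H}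
  {M : Type*} [TopologicalSpace M] [ChartedSpace H M] [IsManifold I ∞ M]
  {E' : Type*} [NormedAddCommGroup E'] [NormedSpace ℝ E']
  {H' : Type*} [TopologicalSpace H'] {J : ModelWithCorners ℝ E' H'}
  {N : Type*} [TopologicalSpace N] [ChartedSpace H' N]

/-- In finite dimension a basis identifies `E →L[ℝ] F` with a finite power of `F`. -/
theorem contMDiffWithinAt_clm_of_apply [FiniteDimensional ℝ E] {F : Type*}
    [NormedAddCommGroup F] [NormedSpace ℝ F]
    {g : N → E →L[ℝ] F} {s : Set N} {q₀ : N} {n : ℕ∞ω}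
    (h : ∀ v, ContMDiffWithinAt J 𝓘(ℝ, F) n (fun q => g q v) s q₀) :
    ContMDiffWithinAt J 𝓘(ℝ, E →L[ℝ] F) n g s q₀ := by
  let d := Module.finrank ℝ E
  have hd : d = Module.finrank ℝ (Fin d → ℝ) := (Module.finrank_fin_fun ℝ).symm
  let e₁ := ContinuousLinearEquiv.ofFinrankEq hd
  let e₂ := (e₁.arrowCongr (1 : F ≃L[ℝ] F)).trans (ContinuousLinearEquiv.piRing (Fin d))
  have h1 : g = e₂.symm ∘ fun q => e₂ (g q) := by ext q : 1; simp
  rw [h1]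
  refine e₂.symm.contDiff.contMDiff.contMDiffAt.comp_contMDiffWithinAt q₀ ?_
  exact contMDiffWithinAt_pi_space.2 fun i => h _

/-- Smoothness of a family of bilinear forms on tangent spaces is tested on the frame of a
trivialization. -/
theorem contMDiffWithinAt_bilinear [FiniteDimensional ℝ E] {b : N → M}
    {φ : ∀ q : N, TangentSpace I (b q) →L[ℝ] TangentSpace I (b q) →L[ℝ] ℝ} {s : Set N} {q₀ : N}
    (hb : ContMDiffWithinAt J I ∞ b s q₀)
    (h : ∀ v w : E, ContMDiffWithinAt J 𝓘(ℝ, ℝ) ∞ (fun q =>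
      φ q ((trivializationAt E (TangentSpace I) (b q₀)).symm (b q) v)
        ((trivializationAt E (TangentSpace I) (b q₀)).symm (b q) w)) s q₀) :
    ContMDiffWithinAt J (I.prod 𝓘(ℝ, E →L[ℝ] E →L[ℝ] ℝ)) ∞
      (fun q => TotalSpace.mk' (E →L[ℝ] E →L[ℝ] ℝ)
        (E := fun p : M => TangentSpace I p →L[ℝ] TangentSpace I p →L[ℝ] ℝ) (b q) (φ q)) s q₀ := by
  rw [contMDiffWithinAt_hom_bundle]
  refine ⟨hb, contMDiffWithinAt_clm_of_apply fun v => contMDiffWithinAt_clm_of_apply fun w => ?_⟩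
  have hbase : ∀ᶠ q in 𝓝[insert q₀ s] q₀,
      b q ∈ (trivializationAt E (TangentSpace I) (b q₀)).baseSet :=
    hb.insert.continuousWithinAt.preimage_mem_nhdsWithin
      ((trivializationAt E (TangentSpace I) (b q₀)).open_baseSet.mem_nhds
        (mem_baseSet_trivializationAt E (TangentSpace I) (b q₀)))
  have key : ∀ q, b q ∈ (trivializationAt E (TangentSpace I) (b q₀)).baseSet →
      ContinuousLinearMap.inCoordinates E (TangentSpace I) (E →L[ℝ] ℝ)
        (fun p : M => TangentSpace I p →L[ℝ] ℝ) (b q₀) (b q) (b q₀) (b q) (φ q) v w =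
      φ q ((trivializationAt E (TangentSpace I) (b q₀)).symm (b q) v)
        ((trivializationAt E (TangentSpace I) (b q₀)).symm (b q) w) := fun q hq => by
    have hq' : b q ∈ (trivializationAt (E →L[ℝ] ℝ) (fun p : M => TangentSpace I p →L[ℝ] ℝ)
        (b q₀)).baseSet := by
      rw [hom_trivializationAt_baseSet]
      exact ⟨hq, mem_univ _⟩
    rw [ContinuousLinearMap.inCoordinates_eq hq hq']
    simp [hom_trivializationAt_apply]
    simp [ContinuousLinearMap.inCoordinates, Trivialization.symmL_apply _ hq]
  refine (h v w).congr_of_eventuallyEq ?_ ?_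
  · filter_upwards [nhdsWithin_mono q₀ (subset_insert q₀ s) hbase] with q hq using key q hq
  · exact key q₀ (mem_baseSet_trivializationAt E (TangentSpace I) (b q₀))

/-- The converse: a smooth family of bilinear forms is smooth on the frame of a trivialization. -/
theorem contMDiffWithinAt_bilinear_apply {b : N → M}
    {φ : ∀ q : N, TangentSpace I (b q) →L[ℝ] TangentSpace I (b q) →L[ℝ] ℝ}
    {v w : ∀ q : N, TangentSpace I (b q)} {s : Set N} {q₀ : N}
    (h : ContMDiffWithinAt J (I.prod 𝓘(ℝ, E →L[ℝ] E →L[ℝ] ℝ)) ∞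
      (fun q => TotalSpace.mk' (E →L[ℝ] E →L[ℝ] ℝ)
        (E := fun p : M => TangentSpace I p →L[ℝ] TangentSpace I p →L[ℝ] ℝ) (b q) (φ q)) s q₀)
    (hv : ContMDiffWithinAt J I.tangent ∞ (fun q => (⟨b q, v q⟩ : TangentBundle I M)) s q₀)
    (hw : ContMDiffWithinAt J I.tangent ∞ (fun q => (⟨b q, w q⟩ : TangentBundle I M)) s q₀) :
    ContMDiffWithinAt J 𝓘(ℝ, ℝ) ∞ (fun q => φ q (v q) (w q)) s q₀ := by
  have : ContMDiffWithinAt J (I.prod 𝓘(ℝ, ℝ)) ∞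
      (fun q => TotalSpace.mk' ℝ (E := Bundle.Trivial M ℝ) (b q) (φ q (v q) (w q))) s q₀ :=
    ContMDiffWithinAt.clm_bundle_apply₂ (F₁ := E) (F₂ := E) h hv hw
  simp only [contMDiffWithinAt_totalSpace] at this
  exact this.2

theorem contMDiffAt_frame (p₀ : M) {p : M}
    (hp : p ∈ (trivializationAt E (TangentSpace I) p₀).baseSet) (v : E) :
    ContMDiffAt I I.tangent ∞ (fun p =>
      (⟨p, (trivializationAt E (TangentSpace I) p₀).symm p v⟩ : TangentBundle I M)) p := by
  set e := trivializationAt E (TangentSpace I : M → Type _) p₀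
  refine (e.contMDiffAt_section_iff hp).2 ?_
  have : ContMDiffAt I 𝓘(ℝ, E) ∞ (fun _ : M => v) p := contMDiffAt_const
  refine this.congr_of_eventuallyEq ?_
  filter_upwards [e.open_baseSet.mem_nhds hp] with q hq
  simp [e.apply_mk_symm hq]

end Bilinear

/-! ### Fields, components and derivatives on the product `M₁ × S¹`. -/

section Product

variable {n : ℕ} {M₁ : Type*} [TopologicalSpace M₁] [ChartedSpace (EuclideanSpace ℝ (Fin n)) M₁]
  [IsManifold (𝓡 n) ∞ M₁]

omit [IsManifold (𝓡 n) ∞ M₁] in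
theorem mem_leafDistribution {p : M₁ × Circle} {v : TangentSpace ((𝓡 n).prod (𝓡 1)) p} :
    v ∈ leafDistribution p ↔ v.2 = 0 := by
  rw [leafDistribution, mfderiv_snd]
  rfl

omit [IsManifold (𝓡 n) ∞ M₁] in
theorem mfderiv_fst_apply (p : M₁ × Circle) (v : TangentSpace ((𝓡 n).prod (𝓡 1)) p) :
    mfderiv ((𝓡 n).prod (𝓡 1)) (𝓡 n) (Prod.fst : M₁ × Circle → M₁) p v = v.1 := by
  rw [mfderiv_fst]; rfl

omit [IsManifold (𝓡 n) ∞ M₁] in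
theorem mfderiv_snd_apply (p : M₁ × Circle) (v : TangentSpace ((𝓡 n).prod (𝓡 1)) p) :
    mfderiv ((𝓡 n).prod (𝓡 1)) (𝓡 1) (Prod.snd : M₁ × Circle → Circle) p v = v.2 := by
  rw [mfderiv_snd]; rfl

/-- The field on `M₁ × S¹` with prescribed components. -/
def prodField (V : VField (𝓡 n) M₁) (Z : VField (𝓡 1) Circle) :
    VField ((𝓡 n).prod (𝓡 1)) (M₁ × Circle) :=
  fun p => (V p.1, Z p.2)

omit [IsManifold (𝓡 n) ∞ M₁] in
theorem fibreLift_eq (N : VField (𝓡 1) Circle) :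
    fibreLift (M₁ := M₁) N = prodField (0 : VField (𝓡 n) M₁) N := by
  funext p
  rw [fibreLift, mfderiv_prod_right]
  rfl

theorem isSmoothField_zero {E : Type*} [NormedAddCommGroup E] [NormedSpace ℝ E]
    {H : Type*} [TopologicalSpace H] {I : ModelWithCorners ℝ E H}
    {M : Type*} [TopologicalSpace M] [ChartedSpace H M] [IsManifold I ∞ M] :
    IsSmoothField I (0 : VField I M) :=
  contMDiff_zeroSection ℝ (TangentSpace I : M → Type _)

theorem isSmoothField_prodField {V : VField (𝓡 n) M₁} {Z : VField (𝓡 1) Circle}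
    (hV : IsSmoothField (𝓡 n) V) (hZ : IsSmoothField (𝓡 1) Z) :
    IsSmoothField ((𝓡 n).prod (𝓡 1)) (prodField V Z) := by
  have : IsManifold (𝓡 n) (∞ + 1) M₁ := by simpa using ‹IsManifold (𝓡 n) ∞ M₁›
  have : IsManifold (𝓡 n) 1 M₁ := IsManifold.of_le (n := ∞) (by simp)
  have h1 : ContMDiff ((𝓡 n).prod (𝓡 1)) ((𝓡 n).tangent.prod (𝓡 1).tangent) ∞
      (fun p : M₁ × Circle => ((⟨p.1, V p.1⟩ : TangentBundle (𝓡 n) M₁),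
        (⟨p.2, Z p.2⟩ : TangentBundle (𝓡 1) Circle))) :=
    (ContMDiff.comp hV contMDiff_fst).prodMk (ContMDiff.comp hZ contMDiff_snd)
  exact (contMDiff_equivTangentBundleProd_symm (n := ∞) (I := 𝓡 n) (I' := 𝓡 1) (M := M₁)
    (M' := Circle)).comp h1

theorem isSmoothField_fibreLift {N : VField (𝓡 1) Circle} (hN : IsSmoothField (𝓡 1) N) :
    IsSmoothField ((𝓡 n).prod (𝓡 1)) (fibreLift (M₁ := M₁) N) := by
  rw [fibreLift_eq]
  exact isSmoothField_prodField isSmoothField_zero hN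

theorem contMDiff_fst_component {N : Type*} {H' E' : Type*} [NormedAddCommGroup E']
    [NormedSpace ℝ E'] [TopologicalSpace H'] {J : ModelWithCorners ℝ E' H'} [TopologicalSpace N]
    [ChartedSpace H' N] {b : N → M₁ × Circle}
    {X : ∀ q, TangentSpace ((𝓡 n).prod (𝓡 1)) (b q)} {s : Set N} {q₀ : N}
    (hX : ContMDiffWithinAt J ((𝓡 n).prod (𝓡 1)).tangent ∞
      (fun q => (⟨b q, X q⟩ : TangentBundle ((𝓡 n).prod (𝓡 1)) (M₁ × Circle))) s q₀) :
    ContMDiffWithinAt J (𝓡 n).tangent ∞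
      (fun q => (⟨(b q).1, (X q).1⟩ : TangentBundle (𝓡 n) M₁)) s q₀ := by
  have : IsManifold (𝓡 n) 1 M₁ := IsManifold.of_le (n := ∞) (by simp)
  have h := (contMDiff_equivTangentBundleProd (n := ∞) (I := 𝓡 n) (I' := 𝓡 1) (M := M₁)
    (M' := Circle)).contMDiffAt.comp_contMDiffWithinAt q₀ hX
  exact contMDiffAt_fst.comp_contMDiffWithinAt q₀ h

theorem contMDiff_snd_component {N : Type*} {H' E' : Type*} [NormedAddCommGroup E']
    [NormedSpace ℝ E'] [TopologicalSpace H'] {J : ModelWithCorners ℝ E' H'} [TopologicalSpace N]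
    [ChartedSpace H' N] {b : N → M₁ × Circle}
    {X : ∀ q, TangentSpace ((𝓡 n).prod (𝓡 1)) (b q)} {s : Set N} {q₀ : N}
    (hX : ContMDiffWithinAt J ((𝓡 n).prod (𝓡 1)).tangent ∞
      (fun q => (⟨b q, X q⟩ : TangentBundle ((𝓡 n).prod (𝓡 1)) (M₁ × Circle))) s q₀) :
    ContMDiffWithinAt J (𝓡 1).tangent ∞
      (fun q => (⟨(b q).2, (X q).2⟩ : TangentBundle (𝓡 1) Circle)) s q₀ := by
  have : IsManifold (𝓡 n) 1 M₁ := IsManifold.of_le (n := ∞) (by simp)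
  have h := (contMDiff_equivTangentBundleProd (n := ∞) (I := 𝓡 n) (I' := 𝓡 1) (M := M₁)
    (M' := Circle)).contMDiffAt.comp_contMDiffWithinAt q₀ hX
  exact contMDiffAt_snd.comp_contMDiffWithinAt q₀ h

theorem contMDiff_app {E : Type*} [NormedAddCommGroup E] [NormedSpace ℝ E]
    {H : Type*} [TopologicalSpace H] {I : ModelWithCorners ℝ E H}
    {M : Type*} [TopologicalSpace M] [ChartedSpace H M] [IsManifold I ∞ M] (g : Metric I M)
    {X Y : VField I M} (hX : IsSmoothField I X) (hY : IsSmoothField I Y) :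
    ContMDiff I 𝓘(ℝ, ℝ) ∞ (g.app X Y) := fun p =>
  contMDiffWithinAt_bilinear_apply (b := id) (φ := g.inner) (g.contMDiff p) (hX p) (hY p)

omit [IsManifold (𝓡 n) ∞ M₁] in
theorem dirDeriv_comp_fst (X : VField ((𝓡 n).prod (𝓡 1)) (M₁ × Circle)) {h : M₁ → ℝ}
    (hh : ContMDiff (𝓡 n) 𝓘(ℝ, ℝ) ∞ h) (p : M₁ × Circle) :
    dirDeriv X (h ∘ Prod.fst) p = mvfderiv (𝓡 n) h p.1 (X p).1 := by
  have := mfderiv_comp_apply (I := (𝓡 n).prod (𝓡 1)) (I' := 𝓡 n) (I'' := 𝓘(ℝ, ℝ)) p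
    (hh.mdifferentiableAt (x := p.1) (by simp)) mdifferentiableAt_fst (X p)
  rw [mfderiv_fst_apply] at this
  exact this

omit [IsManifold (𝓡 n) ∞ M₁] in
theorem dirDeriv_comp_snd (X : VField ((𝓡 n).prod (𝓡 1)) (M₁ × Circle)) {h : Circle → ℝ}
    (hh : ContMDiff (𝓡 1) 𝓘(ℝ, ℝ) ∞ h) (p : M₁ × Circle) :
    dirDeriv X (h ∘ Prod.snd) p = mvfderiv (𝓡 1) h p.2 (X p).2 := by
  have := mfderiv_comp_apply (I := (𝓡 n).prod (𝓡 1)) (I' := 𝓡 1) (I'' := 𝓘(ℝ, ℝ)) p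
    (hh.mdifferentiableAt (x := p.2) (by simp)) mdifferentiableAt_snd (X p)
  rw [mfderiv_snd_apply] at this
  exact this

end Product

/-! ### Differentiation along the fibres and brackets with `N`. -/

section Fibre

variable {n : ℕ} {M₁ : Type*} [TopologicalSpace M₁] [ChartedSpace (EuclideanSpace ℝ (Fin n)) M₁]
  [IsManifold (𝓡 n) ∞ M₁] {g₂ : Metric (𝓡 1) Circle} {N : VField (𝓡 1) Circle} {γ : ℝ → Circle}
  {ℓ : ℝ}

omit [IsManifold (𝓡 n) ∞ M₁] in
theorem contMDiff_fibreCurve (hγ : IsUnitParam g₂ N γ ℓ) (x : M₁) :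
    ContMDiff 𝓘(ℝ, ℝ) ((𝓡 n).prod (𝓡 1)) ∞ (fun s => (x, γ s)) :=
  contMDiff_const.prodMk hγ.smooth

omit [IsManifold (𝓡 n) ∞ M₁] in
/-- The derivative along the fibre through `x` of a function on `M₁ × S¹`. -/
theorem hasDerivAt_fibre (hγ : IsUnitParam g₂ N γ ℓ) {F : M₁ × Circle → ℝ}
    (hF : ContMDiff ((𝓡 n).prod (𝓡 1)) 𝓘(ℝ, ℝ) ∞ F) (x : M₁) (s : ℝ) :
    HasDerivAt (fun s => F (x, γ s)) (dirDeriv (fibreLift (n := n) N) F (x, γ s)) s := by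
  have h1 : ContMDiff 𝓘(ℝ, ℝ) 𝓘(ℝ, ℝ) ∞ (fun s => F (x, γ s)) :=
    hF.comp (contMDiff_fibreCurve hγ x)
  have h2 := ((contMDiff_iff_contDiff.1 h1).differentiable (by simp) s).hasDerivAt
  refine h2.congr_deriv ?_
  have hγs : MDifferentiableAt 𝓘(ℝ, ℝ) (𝓡 1) γ s := hγ.smooth.mdifferentiableAt (by simp)
  have hx : MDifferentiableAt (𝓡 1) ((𝓡 n).prod (𝓡 1)) (fun y : Circle => (x, y)) (γ s) :=
    mdifferentiableAt_const.prodMk mdifferentiableAt_id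
  have h3 := mfderiv_comp_apply s (hF.mdifferentiableAt (x := (x, γ s)) (by simp))
    (f := fun s => (x, γ s)) (hx.comp s hγs) (1 : ℝ)
  have h4 := mfderiv_comp_apply s hx hγs (1 : ℝ)
  rw [hγ.mfderiv_one] at h4
  have h5 : mfderiv 𝓘(ℝ, ℝ) ((𝓡 n).prod (𝓡 1)) (fun s => (x, γ s)) s (1 : ℝ) =
      fibreLift (n := n) N (x, γ s) := h4
  rw [h5] at h3
  refine Eq.trans ?_ h3
  rw [mfderiv_eq_fderiv]
  rfl

/-- The component along `M₁` of a field, on the fibre through `x`: a curve in a fixed vector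
space. -/
def fibreComponent (γ : ℝ → Circle) (X : VField ((𝓡 n).prod (𝓡 1)) (M₁ × Circle)) (x : M₁) (s : ℝ) :
    EuclideanSpace ℝ (Fin n) :=
  (X (x, γ s)).1

/-- Along a fibre the base point `x` does not move, so the coordinate change from its tangent space
to the chart at `x` is the identity. -/
theorem contDiff_fibreComponent (hγ : IsUnitParam g₂ N γ ℓ)
    {X : VField ((𝓡 n).prod (𝓡 1)) (M₁ × Circle)} (hX : IsSmoothField ((𝓡 n).prod (𝓡 1)) X)
    (x : M₁) : ContDiff ℝ ∞ (fibreComponent γ X x) := by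
  rw [contDiff_iff_contDiffAt]
  intro s
  have h := contMDiff_fst_component (b := fun s => (x, γ s)) (X := fun s => X (x, γ s))
    (s := univ) (q₀ := s)
    ((ContMDiff.comp hX (contMDiff_fibreCurve hγ x)).contMDiffAt.contMDiffWithinAt)
  rw [contMDiffWithinAt_totalSpace, contMDiffWithinAt_univ, contMDiffWithinAt_univ] at h
  refine (contMDiffAt_iff_contDiffAt.1 h.2).congr_of_eventuallyEq
    (Eventually.of_forall fun s' => ?_)
  exact (tangentCoordChange_self (I := 𝓡 n) (mem_extChartAt_source x)).symm

variable [T2Space M₁]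

omit [IsManifold (𝓡 n) ∞ M₁] [T2Space M₁] in
theorem fibreLift_ne_zero {g₂ : Metric (𝓡 1) Circle} (hN : ∀ y, g₂.inner y (N y) (N y) = 1)
    (p : M₁ × Circle) : fibreLift (n := n) N p ≠ 0 := fun h => by
  rw [fibreLift_eq] at h
  have h1 : N p.2 = 0 := congrArg Prod.snd h
  have := hN p.2
  simp [h1] at this

/-- Test against functions `k` on `M₁`. The lift of `N` annihilates `k ∘ Prod.fst`, so `[N, X]` acts
on it as `N (X k)`; along the fibre `X k` is the fixed linear form `dk` at `x` applied to the
component of `X`. -/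
theorem deriv_fibreComponent (hγ : IsUnitParam g₂ N γ ℓ) (hN : IsSmoothField (𝓡 1) N)
    (hN1 : ∀ y, g₂.inner y (N y) (N y) = 1)
    {X : VField ((𝓡 n).prod (𝓡 1)) (M₁ × Circle)} (hX : IsSmoothField ((𝓡 n).prod (𝓡 1)) X)
    (x : M₁) :
    deriv (fibreComponent γ X x) =
      fibreComponent γ (VectorField.mlieBracket ((𝓡 n).prod (𝓡 1)) (fibreLift N) X) x := by
  ext1 s
  refine eq_of_forall_mvfderiv_eq (I := 𝓡 n) (p := x) fun k hk => ?_
  have hN' := isSmoothField_fibreLift (M₁ := M₁) (n := n) hN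
  have hkf : ContMDiff ((𝓡 n).prod (𝓡 1)) 𝓘(ℝ, ℝ) ∞ (k ∘ Prod.fst : M₁ × Circle → ℝ) :=
    hk.comp contMDiff_fst
  have h1 := dirDeriv_mlieBracket hN' hX hN' hkf (fibreLift_ne_zero hN1 (x, γ s))
  rw [dirDeriv_comp_fst _ hk] at h1
  have h2 : dirDeriv (fibreLift (n := n) N) (k ∘ Prod.fst : M₁ × Circle → ℝ) = fun _ => 0 := by
    funext p
    rw [dirDeriv_comp_fst _ hk, fibreLift_eq]
    exact map_zero _
  have h3 : dirDeriv X (fun _ : M₁ × Circle => (0 : ℝ)) (x, γ s) = 0 := by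
    rw [dirDeriv, mvfderiv_const]; rfl
  rw [h2, h3, sub_zero] at h1
  have h4 : HasDerivAt (fun s => dirDeriv X (k ∘ Prod.fst) (x, γ s))
      (mvfderiv (𝓡 n) k x (deriv (fibreComponent γ X x) s)) s := by
    have h5 := ((contDiff_fibreComponent hγ hX x).differentiable (by simp) s).hasDerivAt
    let A : EuclideanSpace ℝ (Fin n) →L[ℝ] ℝ := mvfderiv (𝓡 n) k x
    have h6 := A.hasFDerivAt.comp_hasDerivAt s h5
    have h7 : (fun s => dirDeriv X (k ∘ Prod.fst) (x, γ s)) = A ∘ fibreComponent γ X x := by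
      funext s
      rw [dirDeriv_comp_fst _ hk]
      rfl
    rw [h7]
    exact h6
  exact (h1.trans ((hasDerivAt_fibre hγ (contMDiff_dirDeriv hX hkf) x s).unique h4)).symm

omit [T2Space M₁] in
-- Two facts in one: the leaves are integrable, and `N` preserves the foliation. Leaf fields
-- annihilate functions of the circle variable, and the lift of `N` maps such functions to functions
-- of the same kind.
theorem mlieBracket_snd_eq_zero (hN : IsSmoothField (𝓡 1) N)
    (hN1 : ∀ y, g₂.inner y (N y) (N y) = 1)
    {X Y : VField ((𝓡 n).prod (𝓡 1)) (M₁ × Circle)} (hX : IsSmoothField ((𝓡 n).prod (𝓡 1)) X)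
    (hY : IsSmoothField ((𝓡 n).prod (𝓡 1)) Y) (hX0 : X = fibreLift N ∨ ∀ p, (X p).2 = 0)
    (hY0 : ∀ p, (Y p).2 = 0) (p : M₁ × Circle) :
    (VectorField.mlieBracket ((𝓡 n).prod (𝓡 1)) X Y p).2 = 0 := by
  refine eq_of_forall_mvfderiv_eq (I := 𝓡 1) (p := p.2) fun k hk => ?_
  have hN' := isSmoothField_fibreLift (M₁ := M₁) (n := n) hN
  have hkf : ContMDiff ((𝓡 n).prod (𝓡 1)) 𝓘(ℝ, ℝ) ∞ (k ∘ Prod.snd : M₁ × Circle → ℝ) :=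
    hk.comp contMDiff_snd
  have h1 := dirDeriv_mlieBracket hX hY hN' hkf (fibreLift_ne_zero hN1 p)
  rw [dirDeriv_comp_snd _ hk] at h1
  have hzero : ∀ {Z : VField ((𝓡 n).prod (𝓡 1)) (M₁ × Circle)}, (∀ p, (Z p).2 = 0) →
      dirDeriv Z (k ∘ Prod.snd : M₁ × Circle → ℝ) = fun _ => 0 := fun {Z} hZ => by
    funext p
    rw [dirDeriv_comp_snd _ hk, hZ]
    exact map_zero _
  have hconst : ∀ Z : VField ((𝓡 n).prod (𝓡 1)) (M₁ × Circle),
      dirDeriv Z (fun _ : M₁ × Circle => (0 : ℝ)) p = 0 := fun Z => by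
    rw [dirDeriv, mvfderiv_const]; rfl
  rw [hzero hY0, hconst, zero_sub] at h1
  refine h1.trans ((neg_eq_zero.2 ?_).trans (map_zero (mvfderiv (𝓡 1) k p.2)).symm)
  rcases hX0 with rfl | hX0
  · have h2 : ∀ q : M₁ × Circle,
        dirDeriv (fibreLift (n := n) N) (k ∘ Prod.snd : M₁ × Circle → ℝ) q =
        dirDeriv N k q.2 := fun q => by
      rw [dirDeriv_comp_snd _ hk, fibreLift_eq]; rfl
    have h3 : dirDeriv (fibreLift (n := n) N) (k ∘ Prod.snd : M₁ × Circle → ℝ) =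
        dirDeriv N k ∘ Prod.snd := funext h2
    rw [h3, dirDeriv_comp_snd _ (contMDiff_dirDeriv hN hk), hY0]
    exact map_zero _
  · rw [hzero hX0, hconst]

end Fibre

/-! ### The second fundamental form as a derivative along the fibres. -/

section SecondForm

variable {n : ℕ} {M₁ : Type*} [TopologicalSpace M₁] [ChartedSpace (EuclideanSpace ℝ (Fin n)) M₁]
  [IsManifold (𝓡 n) ∞ M₁] {g₂ : Metric (𝓡 1) Circle} {N : VField (𝓡 1) Circle} {γ : ℝ → Circle}
  {ℓ : ℝ}

/-- A vector tangent to `M₁` as a vector tangent to the leaf through `p`. -/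
def leafVector (p : M₁ × Circle) (v : EuclideanSpace ℝ (Fin n)) :
    TangentSpace ((𝓡 n).prod (𝓡 1)) p :=
  ((v, 0) : EuclideanSpace ℝ (Fin n) × EuclideanSpace ℝ (Fin 1))

theorem hasDerivAt_bilinear {E : Type*} [NormedAddCommGroup E] [NormedSpace ℝ E]
    {B : ℝ → E →L[ℝ] E →L[ℝ] ℝ} {u v : ℝ → E} {s : ℝ} (hB : DifferentiableAt ℝ B s)
    (hu : DifferentiableAt ℝ u s) (hv : DifferentiableAt ℝ v s) :
    HasDerivAt (fun s => B s (u s) (v s))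
      (deriv B s (u s) (v s) + B s (deriv u s) (v s) + B s (u s) (deriv v s)) s := by
  have hB' : HasDerivAt B (deriv B s) s :=
    @DifferentiableAt.hasDerivAt ℝ _ (E →L[ℝ] E →L[ℝ] ℝ) inferInstance inferInstance _ _ hB
  exact (hB'.clm_apply hu.hasDerivAt).clm_apply hv.hasDerivAt |>.congr_deriv (by simp)

/-- The restriction of the metric `g` to the leaf through `p`. -/
def leafForm (g : Metric ((𝓡 n).prod (𝓡 1)) (M₁ × Circle)) (p : M₁ × Circle) :
    EuclideanSpace ℝ (Fin n) →L[ℝ] EuclideanSpace ℝ (Fin n) →L[ℝ] ℝ :=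
  ContinuousLinearMap.bilinearComp (E := EuclideanSpace ℝ (Fin n) × EuclideanSpace ℝ (Fin 1))
    (F := EuclideanSpace ℝ (Fin n) × EuclideanSpace ℝ (Fin 1)) (g.inner p)
    (ContinuousLinearMap.inl ℝ _ _) (ContinuousLinearMap.inl ℝ _ _)

theorem leafForm_apply (g : Metric ((𝓡 n).prod (𝓡 1)) (M₁ × Circle)) (p : M₁ × Circle)
    (v w : EuclideanSpace ℝ (Fin n)) :
    leafForm g p v w = g.inner p (leafVector p v) (leafVector p w) := rfl

theorem inner_eq_leafForm (g : Metric ((𝓡 n).prod (𝓡 1)) (M₁ × Circle)) {p : M₁ × Circle}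
    {v w : TangentSpace ((𝓡 n).prod (𝓡 1)) p} (hv : v.2 = 0) (hw : w.2 = 0) :
    g.inner p v w = leafForm g p v.1 w.1 := by
  rw [leafForm_apply, ← show v = leafVector p v.1 from Prod.ext rfl hv,
    ← show w = leafVector p w.1 from Prod.ext rfl hw]

theorem leafForm_symm (g : Metric ((𝓡 n).prod (𝓡 1)) (M₁ × Circle)) (p : M₁ × Circle)
    (v w : EuclideanSpace ℝ (Fin n)) : leafForm g p v w = leafForm g p w v :=
  g.symm p _ _

/-- For fixed `x` these are forms on one fixed vector space, so smoothness can be checked on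
constant vectors, extended to fields lifted from `M₁`. -/
theorem contDiff_leafForm [T2Space M₁] (hγ : IsUnitParam g₂ N γ ℓ)
    (g : Metric ((𝓡 n).prod (𝓡 1)) (M₁ × Circle)) (x : M₁) :
    ContDiff ℝ ∞ (fun s => leafForm g (x, γ s)) := by
  refine contDiff_clm_apply_iff.2 fun v => contDiff_clm_apply_iff.2 fun w => ?_
  obtain ⟨V, hV, rfl⟩ := exists_isSmoothField_eq (I := 𝓡 n) x v
  obtain ⟨W, hW, rfl⟩ := exists_isSmoothField_eq (I := 𝓡 n) x w
  exact contMDiff_iff_contDiff.1 ((contMDiff_app g (isSmoothField_prodField hV isSmoothField_zero)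
    (isSmoothField_prodField hW isSmoothField_zero)).comp (contMDiff_fibreCurve hγ x))

theorem contMDiff_leviCivita {E : Type*} [NormedAddCommGroup E] [NormedSpace ℝ E] [CompleteSpace E]
    {H : Type*} [TopologicalSpace H] {I : ModelWithCorners ℝ E H}
    {M : Type*} [TopologicalSpace M] [ChartedSpace H M] [IsManifold I ∞ M] (g : Metric I M)
    {X Y Z : VField I M} (hX : IsSmoothField I X) (hY : IsSmoothField I Y)
    (hZ : IsSmoothField I Z) : ContMDiff I 𝓘(ℝ, ℝ) ∞ (leviCivita g X Y Z) := by
  have h1 := contMDiff_dirDeriv hX (contMDiff_app g hY hZ)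
  have h2 := contMDiff_dirDeriv hY (contMDiff_app g hX hZ)
  have h3 := contMDiff_dirDeriv hZ (contMDiff_app g hX hY)
  have h4 := contMDiff_app g (hX.mlieBracket hY) hZ
  have h5 := contMDiff_app g (hX.mlieBracket hZ) hY
  have h6 := contMDiff_app g (hY.mlieBracket hZ) hX
  exact (contMDiff_const (I := I) (I' := 𝓘(ℝ, ℝ)) (c := (1 / 2 : ℝ))).smul
    (((((h1.add h2).sub h3).add h4).sub h5).sub h6)

theorem exists_eq_smul {g₂ : Metric (𝓡 1) Circle} (hN1 : ∀ y, g₂.inner y (N y) (N y) = 1)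
    (y : Circle) (v : TangentSpace (𝓡 1) y) : ∃ c : ℝ, v = c • N y := by
  have h0 : N y ≠ 0 := fun h => by
    have := hN1 y
    simp [h] at this
  obtain ⟨c, hc⟩ := exists_smul_eq_of_finrank_eq_one (K := ℝ)
    (finrank_euclideanSpace_fin (𝕜 := ℝ) (n := 1)) (x := (N y : EuclideanSpace ℝ (Fin 1))) h0 v
  exact ⟨c, hc.symm⟩

omit [IsManifold (𝓡 n) ∞ M₁] in
/-- The splitting of a tangent vector in its leaf part and its part along the fibre. -/
theorem eq_leaf_add_smul_fibreLift {p : M₁ × Circle} {v : TangentSpace ((𝓡 n).prod (𝓡 1)) p} {c : ℝ}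
    (hc : v.2 = c • N p.2) : v = leafVector p v.1 + c • fibreLift N p := by
  rw [fibreLift_eq]
  refine Prod.ext ?_ ?_
  · change v.1 = v.1 + c • (0 : EuclideanSpace ℝ (Fin n))
    rw [smul_zero, add_zero]
  · refine hc.trans ?_
    exact (zero_add (c • (N p.2 : EuclideanSpace ℝ (Fin 1)))).symm

theorem inner_leaf_fibreLift {g : Metric ((𝓡 n).prod (𝓡 1)) (M₁ × Circle)}
    (hg : IsAdapted leafDistribution (fibreLift N) g) {p : M₁ × Circle}
    {v : TangentSpace ((𝓡 n).prod (𝓡 1)) p} (hv : v.2 = 0) : g.inner p v (fibreLift N p) = 0 := by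
  rw [g.symm]
  exact (hg p).2 v (mem_leafDistribution.2 hv)

theorem inner_fibreLift {g : Metric ((𝓡 n).prod (𝓡 1)) (M₁ × Circle)}
    (hg : IsAdapted leafDistribution (fibreLift N) g) {p : M₁ × Circle}
    {v : TangentSpace ((𝓡 n).prod (𝓡 1)) p} {c : ℝ} (hc : v.2 = c • N p.2) :
    g.inner p v (fibreLift N p) = c := by
  rw [eq_leaf_add_smul_fibreLift hc, map_add, map_smul, add_apply,
    smul_apply, inner_leaf_fibreLift hg (v := leafVector p v.1) rfl, (hg p).1,
    zero_add, smul_eq_mul, mul_one]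

/-- For an adapted metric the leaf part is the projection along the fibres. -/
theorem leafPart_apply {g : Metric ((𝓡 n).prod (𝓡 1)) (M₁ × Circle)}
    (hN1 : ∀ y, g₂.inner y (N y) (N y) = 1)
    (hg : IsAdapted leafDistribution (fibreLift N) g)
    (X : VField ((𝓡 n).prod (𝓡 1)) (M₁ × Circle)) (p : M₁ × Circle) :
    leafPart g (fibreLift N) X p = leafVector p (X p).1 := by
  obtain ⟨c, hc⟩ := exists_eq_smul hN1 p.2 (X p).2
  rw [leafPart, inner_fibreLift hg hc]
  exact sub_eq_iff_eq_add.2 (eq_leaf_add_smul_fibreLift hc)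

theorem isSmoothField_leafPart {g : Metric ((𝓡 n).prod (𝓡 1)) (M₁ × Circle)}
    (hN : IsSmoothField (𝓡 1) N)
    {X : VField ((𝓡 n).prod (𝓡 1)) (M₁ × Circle)} (hX : IsSmoothField ((𝓡 n).prod (𝓡 1)) X) :
    IsSmoothField ((𝓡 n).prod (𝓡 1)) (leafPart g (fibreLift N) X) :=
  hX.sub ((isSmoothField_fibreLift hN).smul (contMDiff_app g hX (isSmoothField_fibreLift hN)))

variable [T2Space M₁]

/-- In the Koszul formula, orthogonality to `N` kills the first two terms and integrability kills
`g([P, Q], N)`. The rest is `-(1/2) (L_N g)(P, Q)`: the product rule for `N(g(P, Q))` yields terms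
with the derivatives of `P` and `Q`, and these cancel against the two brackets with `N`. -/
theorem secondForm_eq (hγ : IsUnitParam g₂ N γ ℓ) (hN : IsSmoothField (𝓡 1) N)
    (hN1 : ∀ y, g₂.inner y (N y) (N y) = 1) {g : Metric ((𝓡 n).prod (𝓡 1)) (M₁ × Circle)}
    (hg : IsAdapted leafDistribution (fibreLift N) g)
    {X Y : VField ((𝓡 n).prod (𝓡 1)) (M₁ × Circle)}
    (hX : IsSmoothField ((𝓡 n).prod (𝓡 1)) X) (hY : IsSmoothField ((𝓡 n).prod (𝓡 1)) Y)
    (x : M₁) (s : ℝ) :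
    secondForm g (fibreLift N) X Y (x, γ s) = -(1 / 2) *
      deriv (fun s => leafForm g (x, γ s)) s (fibreComponent γ X x s) (fibreComponent γ Y x s) := by
  set U := fibreLift (n := n) (M₁ := M₁) N with hU
  set P := leafPart g U X with hP
  set Q := leafPart g U Y with hQ
  set H := fun s => leafForm g (x, γ s) with hH
  have hU' : IsSmoothField ((𝓡 n).prod (𝓡 1)) U := isSmoothField_fibreLift hN
  have hP' : IsSmoothField ((𝓡 n).prod (𝓡 1)) P := isSmoothField_leafPart hN hX
  have hQ' : IsSmoothField ((𝓡 n).prod (𝓡 1)) Q := isSmoothField_leafPart hN hY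
  have hP2 : ∀ p, (P p).2 = 0 := fun p => by
    rw [hP, leafPart_apply hN1 hg]; rfl
  have hQ2 : ∀ p, (Q p).2 = 0 := fun p => by
    rw [hQ, leafPart_apply hN1 hg]; rfl
  have hP1 : fibreComponent γ P x = fibreComponent γ X x := funext fun s =>
    show (P (x, γ s)).1 = (X (x, γ s)).1 by rw [hP, leafPart_apply hN1 hg]; rfl
  have hQ1 : fibreComponent γ Q x = fibreComponent γ Y x := funext fun s =>
    show (Q (x, γ s)).1 = (Y (x, γ s)).1 by rw [hQ, leafPart_apply hN1 hg]; rfl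
  have hzero : ∀ {Z : VField ((𝓡 n).prod (𝓡 1)) (M₁ × Circle)}, (∀ p, (Z p).2 = 0) →
      g.app Z U = fun _ => 0 := fun {Z} hZ => funext fun p => inner_leaf_fibreLift hg (hZ p)
  have hconst : ∀ Z : VField ((𝓡 n).prod (𝓡 1)) (M₁ × Circle),
      dirDeriv Z (fun _ : M₁ × Circle => (0 : ℝ)) (x, γ s) = 0 := fun Z => by
    rw [dirDeriv, mvfderiv_const]; rfl
  have hbr : ∀ {A B : VField ((𝓡 n).prod (𝓡 1)) (M₁ × Circle)}
      (hA : IsSmoothField ((𝓡 n).prod (𝓡 1)) A) (hB : ∀ p, (B p).2 = 0) (hA2 : ∀ p, (A p).2 = 0),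
      g.app (VectorField.mlieBracket ((𝓡 n).prod (𝓡 1)) A U) B (x, γ s) =
        - H s (deriv (fibreComponent γ A x) s) (fibreComponent γ B x s) := by
    intro A B hA hB hA2
    rw [deriv_fibreComponent hγ hN hN1 hA x, VectorField.mlieBracket_swap, Metric.app]
    have h1 := inner_eq_leafForm g (mlieBracket_snd_eq_zero hN hN1 hU' hA (Or.inl rfl) hA2 (x, γ s))
      (hB (x, γ s))
    rw [Pi.neg_apply, map_neg]
    exact congrArg Neg.neg h1
  have hPQ : HasDerivAt (fun s => g.app P Q (x, γ s))
      (deriv H s (fibreComponent γ X x s) (fibreComponent γ Y x s) +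
        H s (deriv (fibreComponent γ X x) s) (fibreComponent γ Y x s) +
        H s (fibreComponent γ X x s) (deriv (fibreComponent γ Y x) s)) s := by
    have hd : ∀ {Z : VField ((𝓡 n).prod (𝓡 1)) (M₁ × Circle)},
        IsSmoothField ((𝓡 n).prod (𝓡 1)) Z → DifferentiableAt ℝ (fibreComponent γ Z x) s :=
      fun hZ => (contDiff_fibreComponent hγ hZ x).differentiable (by simp) s
    have h1 := hasDerivAt_bilinear ((contDiff_leafForm hγ g x).differentiable (by simp) s)
      (hd hX) (hd hY)
    have h2 : (fun s => g.app P Q (x, γ s)) =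
        fun s => H s (fibreComponent γ X x s) (fibreComponent γ Y x s) := by
      funext s
      rw [← hP1, ← hQ1]
      exact inner_eq_leafForm g (hP2 _) (hQ2 _)
    rw [h2]
    exact h1
  have hUPQ := (hasDerivAt_fibre hγ (contMDiff_app g hP' hQ') x s).unique hPQ
  have hPQ0 : g.app (VectorField.mlieBracket ((𝓡 n).prod (𝓡 1)) P Q) U (x, γ s) = 0 :=
    inner_leaf_fibreLift hg (mlieBracket_snd_eq_zero hN hN1 hP' hQ' (Or.inr hP2) hQ2 _)
  have hsym : H s (deriv (fibreComponent γ Y x) s) (fibreComponent γ X x s) =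
      H s (fibreComponent γ X x s) (deriv (fibreComponent γ Y x) s) := leafForm_symm g _ _ _
  have h1 := hbr hP' hQ2 hP2
  have h2 := hbr hQ' hP2 hQ2
  rw [hP1, hQ1] at h1 h2
  simp only [secondForm, leviCivita, Pi.smul_apply, Pi.add_apply, Pi.sub_apply, smul_eq_mul]
  rw [← hP, ← hQ, hzero hP2, hzero hQ2, hconst, hconst, hUPQ, hPQ0, h1, h2, hsym]
  ring

/-- The right-hand side of the flow is the second derivative, along the fibres, of the metric on
the leaves. -/
theorem lieDeriv_secondForm_eq (hγ : IsUnitParam g₂ N γ ℓ) (hN : IsSmoothField (𝓡 1) N)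
    (hN1 : ∀ y, g₂.inner y (N y) (N y) = 1) {g : Metric ((𝓡 n).prod (𝓡 1)) (M₁ × Circle)}
    (hg : IsAdapted leafDistribution (fibreLift N) g)
    {X Y : VField ((𝓡 n).prod (𝓡 1)) (M₁ × Circle)}
    (hX : IsSmoothField ((𝓡 n).prod (𝓡 1)) X) (hY : IsSmoothField ((𝓡 n).prod (𝓡 1)) Y)
    (x : M₁) (s : ℝ) :
    -2 * lieDeriv (fibreLift N) (secondForm g (fibreLift N)) X Y (x, γ s) =
      deriv (deriv (fun s => leafForm g (x, γ s))) s (fibreComponent γ X x s)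
        (fibreComponent γ Y x s) := by
  have hU' : IsSmoothField ((𝓡 n).prod (𝓡 1)) (fibreLift (n := n) (M₁ := M₁) N) :=
    isSmoothField_fibreLift hN
  have hb : ContMDiff ((𝓡 n).prod (𝓡 1)) 𝓘(ℝ, ℝ) ∞ (secondForm g (fibreLift N) X Y) :=
    contMDiff_leviCivita g (isSmoothField_leafPart hN hX) (isSmoothField_leafPart hN hY) hU'
  set H := fun s => leafForm g (x, γ s) with hH
  have hd : ∀ {Z : VField ((𝓡 n).prod (𝓡 1)) (M₁ × Circle)},
      IsSmoothField ((𝓡 n).prod (𝓡 1)) Z → DifferentiableAt ℝ (fibreComponent γ Z x) s :=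
    fun hZ => (contDiff_fibreComponent hγ hZ x).differentiable (by simp) s
  have hHd : DifferentiableAt ℝ (deriv H) s :=
    (contDiff_infty_iff_deriv.1 (contDiff_leafForm hγ g x)).2.differentiable (by simp) s
  have h1 := (hasDerivAt_bilinear hHd (hd hX) (hd hY)).const_mul (-(1 / 2 : ℝ))
  have h2 : (fun s => secondForm g (fibreLift N) X Y (x, γ s)) = fun s => -(1 / 2 : ℝ) *
      deriv H s (fibreComponent γ X x s) (fibreComponent γ Y x s) :=
    funext fun s => secondForm_eq hγ hN hN1 hg hX hY x s
  have h3 := hasDerivAt_fibre hγ hb x s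
  rw [h2] at h3
  have h4 := h3.unique h1
  simp only [lieDeriv, Pi.sub_apply]
  -- The bracket terms of the Lie derivative cancel the derivatives of the components of `X` and
  -- `Y`, as in the previous computation.
  rw [h4, secondForm_eq hγ hN hN1 hg (hU'.mlieBracket hX) hY,
    secondForm_eq hγ hN hN1 hg hX (hU'.mlieBracket hY), ← deriv_fibreComponent hγ hN hN1 hX,
    ← deriv_fibreComponent hγ hN hN1 hY]
  ring

end SecondForm

/-! ### The heat flow along the fibres of `M₁ × S¹`. -/

section FibreHeat

variable {n : ℕ} {M₁ : Type*} [TopologicalSpace M₁] [ChartedSpace (EuclideanSpace ℝ (Fin n)) M₁]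
  [IsManifold (𝓡 n) ∞ M₁] {g₂ : Metric (𝓡 1) Circle} {N : VField (𝓡 1) Circle} {γ : ℝ → Circle}
  {ℓ : ℝ} {F : M₁ × Circle → ℝ}

/-- The solution at time `t` of the heat equation along the fibres with initial value `F`. -/
def fibreHeat (γ : ℝ → Circle) (F : M₁ × Circle → ℝ) (t : ℝ) (p : M₁ × Circle) : ℝ :=
  ∫ z, F (p.1, γ (Function.invFun γ p.2 + √(2 * t) * z)) ∂(gaussianReal 0 1)

namespace IsUnitParam

theorem apply_invFun (hγ : IsUnitParam g₂ N γ ℓ) (y : Circle) : γ (Function.invFun γ y) = y :=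
  Function.rightInverse_invFun hγ.surjective y

theorem periodic (hγ : IsUnitParam g₂ N γ ℓ) : Function.Periodic γ ℓ := fun s =>
  (hγ.eq_iff (s + ℓ) s).2 ⟨-1, by push_cast; ring⟩

/-- The parameter chosen by `Function.invFun` differs from `s` by a multiple of `ℓ`; hence
`fibreHeat` does not depend on that choice. -/
theorem apply_invFun_add (hγ : IsUnitParam g₂ N γ ℓ) (s a : ℝ) :
    γ (Function.invFun γ (γ s) + a) = γ (s + a) := by
  obtain ⟨m, hm⟩ := (hγ.eq_iff _ _).1 (hγ.apply_invFun (γ s))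
  exact (hγ.eq_iff _ _).2 ⟨m, by linear_combination hm⟩

end IsUnitParam

omit [TopologicalSpace M₁] in
theorem fibreHeat_apply (hγ : IsUnitParam g₂ N γ ℓ) (t : ℝ) (x : M₁) (s : ℝ) :
    fibreHeat γ F t (x, γ s) = ∫ z, F (x, γ (s + √(2 * t) * z)) ∂(gaussianReal 0 1) := by
  simp only [fibreHeat, hγ.apply_invFun_add]

omit [TopologicalSpace M₁] in
-- `√` vanishes on negative reals. Besides the initial value, this makes the family well behaved at
-- the irrelevant negative times, where a metric must still be supplied.
theorem fibreHeat_of_nonpos (hγ : IsUnitParam g₂ N γ ℓ) {t : ℝ} (ht : t ≤ 0) :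
    fibreHeat γ F t = F := by
  funext p
  have : √(2 * t) = 0 := Real.sqrt_eq_zero_of_nonpos (by linarith)
  simp [fibreHeat, this, hγ.apply_invFun]

/-- Near a leaf point, a function on `M₁ × S¹` lifts to a bounded smooth function of a chart of
`M₁` and the parameter of the circle. -/
theorem exists_bddSmooth_lift (hγ : IsUnitParam g₂ N γ ℓ)
    (hF : ContMDiff ((𝓡 n).prod (𝓡 1)) 𝓘(ℝ, ℝ) ∞ F) (x₀ : M₁) :
    ∃ G : EuclideanSpace ℝ (Fin n) × ℝ → ℝ, BddSmooth G ∧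
      ∀ᶠ x in 𝓝 x₀, ∀ s, F (x, γ s) = G (extChartAt (𝓡 n) x₀ x, s) := by
  obtain ⟨b⟩ : Nonempty (SmoothBumpFunction (𝓡 n) x₀) := inferInstance
  set e := extChartAt (𝓡 n) x₀ with he
  set β := b.toContDiffBump with hβ
  -- The bump function is supported inside the chart target, so values of `e.symm` outside it do not
  -- matter, and it equals one near `x₀`, where `G` is the lift.
  let G : EuclideanSpace ℝ (Fin n) × ℝ → ℝ := fun q => β q.1 * F (e.symm q.1, γ q.2)
  have hball : Metric.closedBall (e x₀) β.rOut ⊆ e.target := fun w hw =>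
    b.closedBall_subset ⟨hw, by simp⟩
  have hzero : ∀ w ∉ Metric.closedBall (e x₀) β.rOut, β w = 0 := fun w hw =>
    β.zero_of_le_dist (le_of_lt (not_le.1 hw))
  have hG : ContDiff ℝ ∞ G := by
    rw [contDiff_iff_contDiffAt]
    rintro ⟨w, s⟩
    by_cases hw : w ∈ Metric.closedBall (e x₀) β.rOut
    · have h1 : ContMDiffAt 𝓘(ℝ, EuclideanSpace ℝ (Fin n)) (𝓡 n) ∞ e.symm w :=
        (contMDiffOn_extChartAt_symm x₀).contMDiffAt
          ((isOpen_extChartAt_target x₀).mem_nhds (hball hw))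
      have h2 : ContMDiffAt 𝓘(ℝ, EuclideanSpace ℝ (Fin n) × ℝ) (𝓡 n) ∞
          (fun q : EuclideanSpace ℝ (Fin n) × ℝ => e.symm q.1) (w, s) :=
        ContMDiffAt.comp (w, s) (f := Prod.fst) h1 contDiff_fst.contMDiff.contMDiffAt
      have h3 : ContMDiffAt 𝓘(ℝ, EuclideanSpace ℝ (Fin n) × ℝ) (𝓡 1) ∞
          (fun q : EuclideanSpace ℝ (Fin n) × ℝ => γ q.2) (w, s) :=
        ContMDiffAt.comp (w, s) (f := Prod.snd) hγ.smooth.contMDiffAt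
          contDiff_snd.contMDiff.contMDiffAt
      have h4 := (hF.contMDiffAt (x := (e.symm w, γ s))).comp (w, s) (h2.prodMk h3)
      have h5 : ContDiffAt ℝ ∞ (fun q : EuclideanSpace ℝ (Fin n) × ℝ => β q.1) (w, s) :=
        (β.contDiff.comp contDiff_fst).contDiffAt
      exact h5.mul (contMDiffAt_iff_contDiffAt.1 h4)
    · refine contDiffAt_const (c := (0 : ℝ)) |>.congr_of_eventuallyEq ?_
      have : ∀ᶠ q : EuclideanSpace ℝ (Fin n) × ℝ in 𝓝 (w, s),
          q.1 ∉ Metric.closedBall (e x₀) β.rOut :=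
        (Metric.isClosed_closedBall.isOpen_compl.preimage continuous_fst).mem_nhds hw
      filter_upwards [this] with q hq
      change β q.1 * _ = 0
      rw [hzero q.1 hq, zero_mul]
  refine ⟨G, BddSmooth.of_periodic hG hγ.pos (fun w s => ?_)
    (isCompact_closedBall (e x₀) β.rOut) (fun w hw s => ?_), ?_⟩
  · simp only [G, hγ.periodic s]
  · change β w * _ = 0
    rw [hzero w hw, zero_mul]
  · filter_upwards [b.eventuallyEq_one, extChartAt_source_mem_nhds (I := 𝓡 n) x₀] with x hx hxs s
    rw [b.eqOn_source (by rwa [extChartAt_source] at hxs)] at hx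
    have hx' : β (e x) = 1 := hx
    simp only [G, hx', one_mul]
    rw [e.left_inv hxs]

omit [TopologicalSpace M₁] in
theorem fibreHeat_eq_gaussHeat (hγ : IsUnitParam g₂ N γ ℓ) {W : Type*} [NormedAddCommGroup W]
    [NormedSpace ℝ W] {G : W × ℝ → ℝ} {x : M₁} {w : W} (h : ∀ s, F (x, γ s) = G (w, s))
    (t s : ℝ) : fibreHeat γ F t (x, γ s) = gaussHeat ((0 : W), (1 : ℝ)) G t (w, s) := by
  rw [fibreHeat_apply hγ, gaussHeat]
  simp [h]

/-- The heat flow along the fibres is smooth up to the initial time. -/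
theorem contMDiffOn_fibreHeat (hγ : IsUnitParam g₂ N γ ℓ)
    (hF : ContMDiff ((𝓡 n).prod (𝓡 1)) 𝓘(ℝ, ℝ) ∞ F) :
    ContMDiffOn (𝓘(ℝ, ℝ).prod ((𝓡 n).prod (𝓡 1))) 𝓘(ℝ, ℝ) ∞
      (fun q : ℝ × (M₁ × Circle) => fibreHeat γ F q.1 q.2) (Ici 0 ×ˢ univ) := by
  rintro ⟨t₀, x₀, y₀⟩ ⟨ht₀, -⟩
  obtain ⟨s₀, rfl⟩ := hγ.surjective y₀
  obtain ⟨G, hG, hFG⟩ := exists_bddSmooth_lift hγ hF x₀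
  obtain ⟨σ, hσ, hγσ⟩ := hγ.exists_section s₀
  have h1 : ContMDiffWithinAt 𝓘(ℝ, ℝ × (EuclideanSpace ℝ (Fin n) × ℝ)) 𝓘(ℝ, ℝ) ∞
      (fun q : ℝ × (EuclideanSpace ℝ (Fin n) × ℝ) =>
        gaussHeat ((0 : EuclideanSpace ℝ (Fin n)), (1 : ℝ)) G q.1 q.2) (Ici 0 ×ˢ univ)
      (t₀, extChartAt (𝓡 n) x₀ x₀, σ (γ s₀)) :=
    ((contDiffOn_gaussHeat hG _).contMDiffOn) _ ⟨ht₀, mem_univ _⟩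
  have h2 : ContMDiffAt (𝓘(ℝ, ℝ).prod ((𝓡 n).prod (𝓡 1)))
      𝓘(ℝ, ℝ × (EuclideanSpace ℝ (Fin n) × ℝ)) ∞
      (fun q : ℝ × (M₁ × Circle) => (q.1, extChartAt (𝓡 n) x₀ q.2.1, σ q.2.2))
      (t₀, x₀, γ s₀) := by
    have hx : ContMDiffAt (𝓘(ℝ, ℝ).prod ((𝓡 n).prod (𝓡 1))) 𝓘(ℝ, EuclideanSpace ℝ (Fin n)) ∞
        (fun q : ℝ × (M₁ × Circle) => extChartAt (𝓡 n) x₀ q.2.1) (t₀, x₀, γ s₀) :=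
      ContMDiffAt.comp (t₀, x₀, γ s₀) (f := fun q : ℝ × (M₁ × Circle) => q.2.1)
        contMDiffAt_extChartAt (contMDiff_fst.comp contMDiff_snd).contMDiffAt
    have hy : ContMDiffAt (𝓘(ℝ, ℝ).prod ((𝓡 n).prod (𝓡 1))) 𝓘(ℝ, ℝ) ∞
        (fun q : ℝ × (M₁ × Circle) => σ q.2.2) (t₀, x₀, γ s₀) :=
      ContMDiffAt.comp (t₀, x₀, γ s₀) (f := fun q : ℝ × (M₁ × Circle) => q.2.2)
        hσ (contMDiff_snd.comp contMDiff_snd).contMDiffAt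
    exact contMDiffAt_fst.prodMk_space (hx.prodMk_space hy)
  have h3 := h1.comp (t₀, x₀, γ s₀) (h2.contMDiffWithinAt (s := Ici 0 ×ˢ univ))
    (fun q (hq : q ∈ Ici 0 ×ˢ univ) => mem_prod.2 ⟨hq.1, mem_univ _⟩)
  -- The bump factor depends only on the `M₁` variable, so averaging along the fibre commutes with
  -- the localization; `σ` supplies the circle parameter smoothly.
  have h4 : ∀ᶠ q : ℝ × (M₁ × Circle) in 𝓝 (t₀, x₀, γ s₀), fibreHeat γ F q.1 q.2 =
      gaussHeat ((0 : EuclideanSpace ℝ (Fin n)), (1 : ℝ)) G q.1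
        (extChartAt (𝓡 n) x₀ q.2.1, σ q.2.2) := by
    have ha : ∀ᶠ q : ℝ × (M₁ × Circle) in 𝓝 (t₀, x₀, γ s₀),
        ∀ s, F (q.2.1, γ s) = G (extChartAt (𝓡 n) x₀ q.2.1, s) :=
      ((continuous_fst.comp continuous_snd).tendsto (t₀, x₀, γ s₀)).eventually hFG
    have hb : ∀ᶠ q : ℝ × (M₁ × Circle) in 𝓝 (t₀, x₀, γ s₀), γ (σ q.2.2) = q.2.2 :=
      ((continuous_snd.comp continuous_snd).tendsto (t₀, x₀, γ s₀)).eventually hγσ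
    filter_upwards [ha, hb] with q hqa hqb
    rw [← fibreHeat_eq_gaussHeat hγ hqa, hqb]
  exact h3.congr_of_eventuallyEq (h4.filter_mono nhdsWithin_le_nhds) h4.self_of_nhds

theorem contMDiff_fibreHeat (hγ : IsUnitParam g₂ N γ ℓ)
    (hF : ContMDiff ((𝓡 n).prod (𝓡 1)) 𝓘(ℝ, ℝ) ∞ F) (t : ℝ) :
    ContMDiff ((𝓡 n).prod (𝓡 1)) 𝓘(ℝ, ℝ) ∞ (fibreHeat γ F t) := by
  rcases le_or_gt t 0 with ht | ht
  · rwa [fibreHeat_of_nonpos hγ ht]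
  · exact (contMDiffOn_fibreHeat hγ hF).comp_contMDiff (contMDiff_const.prodMk contMDiff_id)
      (fun p => ⟨ht.le, mem_univ _⟩)

/-- The heat equation along the fibres. -/
theorem hasDerivWithinAt_fibreHeat (hγ : IsUnitParam g₂ N γ ℓ)
    (hF : ContMDiff ((𝓡 n).prod (𝓡 1)) 𝓘(ℝ, ℝ) ∞ F) (x : M₁) (s t : ℝ) :
    HasDerivWithinAt (fun t => fibreHeat γ F t (x, γ s))
      (deriv (deriv (fun s => fibreHeat γ F t (x, γ s))) s) (Ici 0) t := by
  obtain ⟨G, hG, hFG⟩ := exists_bddSmooth_lift hγ hF x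
  set w := extChartAt (𝓡 n) x x
  set e : EuclideanSpace ℝ (Fin n) × ℝ := (0, 1) with he
  have h : ∀ t s, fibreHeat γ F t (x, γ s) = gaussHeat e G t (w, s) :=
    fibreHeat_eq_gaussHeat hγ hFG.self_of_nhds
  have hline : ∀ s : ℝ, (w, s) = (w, (0 : ℝ)) + s • e := fun s => by simp [he]
  have hd : ∀ {K : EuclideanSpace ℝ (Fin n) × ℝ → ℝ}, BddSmooth K →
      deriv (fun s => gaussHeat e K t (w, s)) =
        fun s => gaussHeat e (fun q => fderiv ℝ K q e) t (w, s) := fun {K} hK => by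
    funext s
    have h1 := (hasDerivAt_gaussHeat_line hK e t (w, 0) s).deriv
    rw [← hline s] at h1
    rw [← h1]
    exact congrArg (fun φ => deriv φ s) (funext fun r => by rw [← hline r])
  simp only [h]
  rw [hd hG, hd (hG.dirDeriv e)]
  exact hasDerivWithinAt_gaussHeat_time hG e t (w, s)

/-- In a chart the mean is an integral over one period of translates of a bounded smooth function,
so differentiation under the integral applies. -/
theorem contMDiff_fibreMean (hγ : IsUnitParam g₂ N γ ℓ)
    (hF : ContMDiff ((𝓡 n).prod (𝓡 1)) 𝓘(ℝ, ℝ) ∞ F) :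
    ContMDiff (𝓡 n) 𝓘(ℝ, ℝ) ∞ (fun x => circleMean g₂ (fun y => F (x, y))) := by
  intro x₀
  obtain ⟨G, hG, hFG⟩ := exists_bddSmooth_lift hγ hF x₀
  have h1 := contDiff_integral_translate hG (μ := volume.restrict (Ioc 0 ℓ))
    (ψ := fun u => ((0 : EuclideanSpace ℝ (Fin n)), u)) (by fun_prop)
  have h2 : ContDiff ℝ ∞ (fun w : EuclideanSpace ℝ (Fin n) =>
      (∫ u in Ioc 0 ℓ, G ((w, (0 : ℝ)) + (0, u))) / ℓ) :=
    (h1.comp (contDiff_id.prodMk contDiff_const)).div_const ℓ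
  have h3 : ContMDiffAt (𝓡 n) 𝓘(ℝ, ℝ) ∞ (fun x : M₁ =>
      (∫ u in Ioc 0 ℓ, G ((extChartAt (𝓡 n) x₀ x, (0 : ℝ)) + (0, u))) / ℓ) x₀ :=
    ContMDiffAt.comp x₀ (f := extChartAt (𝓡 n) x₀) h2.contMDiff.contMDiffAt contMDiffAt_extChartAt
  refine h3.congr_of_eventuallyEq ?_
  filter_upwards [hFG] with x hx
  have hc : Continuous fun y => F (x, y) :=
    hF.continuous.comp (continuous_const.prodMk continuous_id)
  rw [hγ.mean _ hc, intervalIntegral.integral_of_le hγ.pos.le]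
  simp [hx]

omit [IsManifold (𝓡 n) ∞ M₁] in
-- The positive lower bound serves both positivity at all times and the comparison with the limit
-- metric; the upper bound enters the rate of convergence.
theorem exists_bounds [CompactSpace M₁]
    (hF : ContMDiff ((𝓡 n).prod (𝓡 1)) 𝓘(ℝ, ℝ) ∞ F) (hpos : ∀ p, 0 < F p) :
    ∃ m B, 0 < m ∧ ∀ p, m ≤ F p ∧ F p ≤ B := by
  rcases isEmpty_or_nonempty (M₁ × Circle) with h | h
  · exact ⟨1, 1, one_pos, fun p => h.elim p⟩
  · obtain ⟨a, -, ha⟩ := isCompact_univ.exists_isMinOn univ_nonempty hF.continuous.continuousOn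
    obtain ⟨b, -, hb⟩ := isCompact_univ.exists_isMaxOn univ_nonempty hF.continuous.continuousOn
    exact ⟨F a, F b, hpos a, fun p => ⟨ha (mem_univ p), hb (mem_univ p)⟩⟩

theorem le_fibreHeat (hγ : IsUnitParam g₂ N γ ℓ) (hF : Continuous F) {m B : ℝ}
    (hm : ∀ p, m ≤ F p) (hB : ∀ p, F p ≤ B) (t : ℝ) (p : M₁ × Circle) : m ≤ fibreHeat γ F t p := by
  have hc : Continuous fun z => F (p.1, γ (Function.invFun γ p.2 + √(2 * t) * z)) :=
    hF.comp (continuous_const.prodMk (hγ.smooth.continuous.comp (by fun_prop)))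
  have hi : Integrable (fun z => F (p.1, γ (Function.invFun γ p.2 + √(2 * t) * z)))
      (gaussianReal 0 1) :=
    Integrable.of_bound hc.aestronglyMeasurable (max |m| |B|) (ae_of_all _ fun z =>
      abs_le_max_abs_abs (hm _) (hB _))
  have h := integral_mono (integrable_const m) hi (fun z => hm _)
  rwa [integral_const, probReal_univ, one_smul] at h

theorem le_circleMean (hγ : IsUnitParam g₂ N γ ℓ) (hF : Continuous F) {m : ℝ}
    (hm : ∀ p, m ≤ F p) (x : M₁) : m ≤ circleMean g₂ (fun y => F (x, y)) := by
  have hc : Continuous fun y => F (x, y) := hF.comp (continuous_const.prodMk continuous_id)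
  rw [hγ.mean _ hc, le_div_iff₀ hγ.pos]
  have h := intervalIntegral.integral_mono_on (μ := volume) hγ.pos.le
    (intervalIntegrable_const (c := m))
    ((hc.comp hγ.smooth.continuous).intervalIntegrable 0 ℓ) (fun s _ => hm _)
  simpa [mul_comm] using h

/-- The heat flow along the fibres converges uniformly to the mean over the fibres. -/
theorem abs_fibreHeat_sub_circleMean_le (hγ : IsUnitParam g₂ N γ ℓ) (hF : Continuous F)
    {B : ℝ} (hB : ∀ p, |F p| ≤ B) {t : ℝ} (ht : 0 < t) (p : M₁ × Circle) :
    |fibreHeat γ F t p - circleMean g₂ (fun y => F (p.1, y))| ≤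
      2 * B * ℓ * (∫ z, |z| ∂(gaussianReal 0 1)) / √(2 * t) := by
  have hc : Continuous fun y => F (p.1, y) := hF.comp (continuous_const.prodMk continuous_id)
  rw [hγ.mean _ hc]
  exact abs_gaussian_average_sub_mean_le (φ := fun s => F (p.1, γ s))
    (hc.comp hγ.smooth.continuous) hγ.pos (fun s => by simp only [hγ.periodic s])
    (fun s => hB _) (Real.sqrt_pos.2 (by linarith)) _

end FibreHeat

/-! ### The metrics `(c g₁) ⊕ g₂` and the determination of adapted metrics by their leaf forms. -/

section ScaledMetric

/-- The minimum of `B v v` on the compact unit sphere is positive and bounds `B v v` below by a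
multiple of `‖v‖ ^ 2`. This is the boundedness field of a Riemannian metric. -/
theorem isVonNBounded_of_posDef {E : Type*} [NormedAddCommGroup E] [NormedSpace ℝ E]
    [FiniteDimensional ℝ E] (B : E →L[ℝ] E →L[ℝ] ℝ) (hB : ∀ v, v ≠ 0 → 0 < B v v) :
    Bornology.IsVonNBounded ℝ {v : E | B v v < 1} := by
  rw [NormedSpace.isVonNBounded_iff]
  rcases subsingleton_or_nontrivial E with hE | hE
  · exact (Set.toFinite _).isBounded
  have hc : Continuous fun v => B v v := by fun_prop
  obtain ⟨u, hu, hmin⟩ := (isCompact_sphere (0 : E) 1).exists_isMinOn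
    (NormedSpace.sphere_nonempty.2 zero_le_one) hc.continuousOn
  have hu0 : u ≠ 0 := by
    rintro rfl
    simp at hu
  have hm := hB u hu0
  -- The radius comes from `‖v‖ ^ 2 ≤ 1 / B u u` and the crude bound `‖v‖ ≤ ‖v‖ ^ 2 + 1`.
  refine (Metric.isBounded_closedBall (x := (0 : E)) (r := 1 / B u u + 1)).subset fun v hv => ?_
  rw [mem_closedBall_zero_iff]
  have hv1 : B v v < 1 := hv
  rcases eq_or_ne v 0 with rfl | hv0
  · rw [norm_zero]; positivity
  have hn : 0 < ‖v‖ := norm_pos_iff.2 hv0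
  have h1 : B u u ≤ B (‖v‖⁻¹ • v) (‖v‖⁻¹ • v) := hmin (by simp [norm_smul, hn.ne'])
  have h2 : B (‖v‖⁻¹ • v) (‖v‖⁻¹ • v) = ‖v‖⁻¹ * (‖v‖⁻¹ * B v v) := by simp
  rw [h2] at h1
  have h3 : ‖v‖ ^ 2 * B u u ≤ B v v := by
    calc ‖v‖ ^ 2 * B u u ≤ ‖v‖ ^ 2 * (‖v‖⁻¹ * (‖v‖⁻¹ * B v v)) := by gcongr
      _ = B v v := by field_simp
  have h4 : ‖v‖ ^ 2 ≤ 1 / B u u := by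
    rw [le_div_iff₀ hm]
    linarith
  nlinarith [sq_nonneg (‖v‖ - 1)]

theorem _root_.Bundle.ContMDiffRiemannianMetric.inner_self_nonneg {E : Type*} [NormedAddCommGroup E]
    [NormedSpace ℝ E] {H : Type*} [TopologicalSpace H] {I : ModelWithCorners ℝ E H}
    {M : Type*} [TopologicalSpace M] [ChartedSpace H M] [IsManifold I ∞ M] (g : Metric I M) (p : M)
    (v : TangentSpace I p) : 0 ≤ g.inner p v v := by
  by_cases hv : v = 0
  · rw [hv, map_zero]
  · exact (g.pos p v hv).le

variable {n : ℕ} {M₁ : Type*} [TopologicalSpace M₁] [ChartedSpace (EuclideanSpace ℝ (Fin n)) M₁]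
  [IsManifold (𝓡 n) ∞ M₁]

/-- The bilinear form `(a g₁) ⊕ g₂` at the point `p`. -/
def scaledForm (g₁ : Metric (𝓡 n) M₁) (g₂ : Metric (𝓡 1) Circle) (a : ℝ) (p : M₁ × Circle) :
    TangentSpace ((𝓡 n).prod (𝓡 1)) p →L[ℝ] TangentSpace ((𝓡 n).prod (𝓡 1)) p →L[ℝ] ℝ :=
  let A₁ : EuclideanSpace ℝ (Fin n) →L[ℝ] EuclideanSpace ℝ (Fin n) →L[ℝ] ℝ := g₁.inner p.1
  let A₂ : EuclideanSpace ℝ (Fin 1) →L[ℝ] EuclideanSpace ℝ (Fin 1) →L[ℝ] ℝ := g₂.inner p.2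
  let P₁ := ContinuousLinearMap.fst ℝ (EuclideanSpace ℝ (Fin n)) (EuclideanSpace ℝ (Fin 1))
  let P₂ := ContinuousLinearMap.snd ℝ (EuclideanSpace ℝ (Fin n)) (EuclideanSpace ℝ (Fin 1))
  a • A₁.bilinearComp P₁ P₁ + A₂.bilinearComp P₂ P₂

theorem scaledForm_apply (g₁ : Metric (𝓡 n) M₁) (g₂ : Metric (𝓡 1) Circle) (a : ℝ)
    (p : M₁ × Circle) (v w : TangentSpace ((𝓡 n).prod (𝓡 1)) p) :
    scaledForm g₁ g₂ a p v w = a * g₁.inner p.1 v.1 w.1 + g₂.inner p.2 v.2 w.2 := rfl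

/-- The base map `b` is arbitrary so that one statement covers a single metric (`b = id`) and a
family depending on time (`b` the projection to `M₁ × S¹`). -/
theorem contMDiffWithinAt_scaledForm (g₁ : Metric (𝓡 n) M₁) (g₂ : Metric (𝓡 1) Circle)
    {N : Type*} {H' E' : Type*} [NormedAddCommGroup E'] [NormedSpace ℝ E'] [TopologicalSpace H']
    {J : ModelWithCorners ℝ E' H'} [TopologicalSpace N] [ChartedSpace H' N] {b : N → M₁ × Circle}
    {c : N → ℝ} {s : Set N} {q₀ : N}
    (hb : ContMDiffWithinAt J ((𝓡 n).prod (𝓡 1)) ∞ b s q₀)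
    (hc : ContMDiffWithinAt J 𝓘(ℝ, ℝ) ∞ c s q₀) :
    ContMDiffWithinAt J (((𝓡 n).prod (𝓡 1)).prod 𝓘(ℝ, (EuclideanSpace ℝ (Fin n) ×
        EuclideanSpace ℝ (Fin 1)) →L[ℝ] (EuclideanSpace ℝ (Fin n) × EuclideanSpace ℝ (Fin 1))
        →L[ℝ] ℝ)) ∞
      (fun q => TotalSpace.mk' ((EuclideanSpace ℝ (Fin n) ×
        EuclideanSpace ℝ (Fin 1)) →L[ℝ] (EuclideanSpace ℝ (Fin n) × EuclideanSpace ℝ (Fin 1))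
        →L[ℝ] ℝ)
        (E := fun p : M₁ × Circle => TangentSpace ((𝓡 n).prod (𝓡 1)) p →L[ℝ]
          TangentSpace ((𝓡 n).prod (𝓡 1)) p →L[ℝ] ℝ) (b q)
        (scaledForm g₁ g₂ (c q) (b q))) s q₀ := by
  refine contMDiffWithinAt_bilinear (I := (𝓡 n).prod (𝓡 1)) hb fun v w => ?_
  have hframe : ∀ v : EuclideanSpace ℝ (Fin n) × EuclideanSpace ℝ (Fin 1),
      ContMDiffWithinAt J ((𝓡 n).prod (𝓡 1)).tangent ∞ (fun q =>
        (⟨b q, (trivializationAt (EuclideanSpace ℝ (Fin n) × EuclideanSpace ℝ (Fin 1))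
          (TangentSpace ((𝓡 n).prod (𝓡 1))) (b q₀)).symm (b q) v⟩ :
          TangentBundle ((𝓡 n).prod (𝓡 1)) (M₁ × Circle))) s q₀ := fun v =>
    (contMDiffAt_frame (I := (𝓡 n).prod (𝓡 1)) (b q₀)
      (mem_baseSet_trivializationAt _ _ (b q₀)) v).comp_contMDiffWithinAt q₀ hb
  have h1 := contMDiffWithinAt_bilinear_apply (b := fun q => (b q).1)
    (φ := fun q => g₁.inner (b q).1)
    (g₁.contMDiff.contMDiffAt.comp_contMDiffWithinAt q₀
      (contMDiffAt_fst.comp_contMDiffWithinAt q₀ hb))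
    (contMDiff_fst_component (hframe v)) (contMDiff_fst_component (hframe w))
  have h2 := contMDiffWithinAt_bilinear_apply (b := fun q => (b q).2)
    (φ := fun q => g₂.inner (b q).2)
    (g₂.contMDiff.contMDiffAt.comp_contMDiffWithinAt q₀
      (contMDiffAt_snd.comp_contMDiffWithinAt q₀ hb))
    (contMDiff_snd_component (hframe v)) (contMDiff_snd_component (hframe w))
  exact (hc.mul h1).add h2

/-- The metric `(c g₁) ⊕ g₂`. -/
def scaledMetric (g₁ : Metric (𝓡 n) M₁) (g₂ : Metric (𝓡 1) Circle) (c : M₁ × Circle → ℝ)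
    (hc : ContMDiff ((𝓡 n).prod (𝓡 1)) 𝓘(ℝ, ℝ) ∞ c) (hpos : ∀ p, 0 < c p) :
    Metric ((𝓡 n).prod (𝓡 1)) (M₁ × Circle) :=
  have hp : ∀ (p : M₁ × Circle) (v : TangentSpace ((𝓡 n).prod (𝓡 1)) p), v ≠ 0 →
      0 < scaledForm g₁ g₂ (c p) p v v := fun p v hv => by
    rw [scaledForm_apply]
    by_cases h1 : v.1 = 0
    · exact add_pos_of_nonneg_of_pos (mul_nonneg (hpos p).le (g₁.inner_self_nonneg p.1 v.1))
        (g₂.pos p.2 v.2 fun h2 => hv (Prod.ext h1 h2))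
    · exact add_pos_of_pos_of_nonneg (mul_pos (hpos p) (g₁.pos p.1 v.1 h1))
        (g₂.inner_self_nonneg p.2 v.2)
  { inner := fun p => scaledForm g₁ g₂ (c p) p
    symm := fun p v w => congrArg₂ (fun a b => c p * a + b) (g₁.symm p.1 v.1 w.1)
      (g₂.symm p.2 v.2 w.2)
    pos := hp
    isVonNBounded := fun p => isVonNBounded_of_posDef
      (E := EuclideanSpace ℝ (Fin n) × EuclideanSpace ℝ (Fin 1)) (scaledForm g₁ g₂ (c p) p) (hp p)
    contMDiff := fun p => contMDiffWithinAt_scaledForm g₁ g₂ contMDiffWithinAt_id (hc p) }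

/-- The metric `c g` conformal to `g`. -/
def conformalMetric (g : Metric (𝓡 n) M₁) (c : M₁ → ℝ) (hc : ContMDiff (𝓡 n) 𝓘(ℝ, ℝ) ∞ c)
    (hpos : ∀ p, 0 < c p) : Metric (𝓡 n) M₁ :=
  { inner := fun p => c p • g.inner p
    symm := fun p v w => congrArg (c p * ·) (g.symm p v w)
    pos := fun p v hv => mul_pos (hpos p) (g.pos p v hv)
    isVonNBounded := fun p => isVonNBounded_of_posDef
      (E := EuclideanSpace ℝ (Fin n)) (c p • g.inner p) fun v hv => mul_pos (hpos p) (g.pos p v hv)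
    contMDiff := ContMDiff.smul_section hc g.contMDiff }

variable {g₁ : Metric (𝓡 n) M₁} {g₂ : Metric (𝓡 1) Circle} {N : VField (𝓡 1) Circle}
  {c : M₁ × Circle → ℝ} {g : Metric ((𝓡 n).prod (𝓡 1)) (M₁ × Circle)}

theorem isScaledSum_scaledMetric (hc : ContMDiff ((𝓡 n).prod (𝓡 1)) 𝓘(ℝ, ℝ) ∞ c)
    (hpos : ∀ p, 0 < c p) : IsScaledSum g₁ g₂ c (scaledMetric g₁ g₂ c hc hpos) := fun p v w => by
  rw [mfderiv_fst_apply, mfderiv_fst_apply, mfderiv_snd_apply, mfderiv_snd_apply]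
  rfl

theorem IsScaledSum.inner_eq (h : IsScaledSum g₁ g₂ c g) (p : M₁ × Circle)
    (v w : TangentSpace ((𝓡 n).prod (𝓡 1)) p) :
    g.inner p v w = c p * g₁.inner p.1 v.1 w.1 + g₂.inner p.2 v.2 w.2 := by
  rw [h p v w, mfderiv_fst_apply, mfderiv_fst_apply, mfderiv_snd_apply, mfderiv_snd_apply]

theorem IsScaledSum.leafForm_eq (h : IsScaledSum g₁ g₂ c g) (p : M₁ × Circle)
    (v w : EuclideanSpace ℝ (Fin n)) : leafForm g p v w = c p * g₁.inner p.1 v w := by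
  rw [leafForm_apply, h.inner_eq]
  have : g₂.inner p.2 (leafVector p v).2 (leafVector p w).2 = 0 :=
    map_zero (g₂.inner p.2 (leafVector p v).2)
  rw [this, add_zero]
  rfl

theorem IsScaledSum.isAdapted (hN1 : ∀ y, g₂.inner y (N y) (N y) = 1)
    (h : IsScaledSum g₁ g₂ c g) : IsAdapted leafDistribution (fibreLift N) g := fun p => by
  have h0 : ∀ v : TangentSpace ((𝓡 n).prod (𝓡 1)) p,
      g.inner p (fibreLift N p) v = g₂.inner p.2 (N p.2) v.2 := fun v => by
    rw [h.inner_eq, fibreLift_eq]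
    have : g₁.inner p.1 (prodField (0 : VField (𝓡 n) M₁) N p).1 v.1 = 0 :=
      congrArg (fun A : TangentSpace (𝓡 n) p.1 →L[ℝ] ℝ => A v.1) (map_zero (g₁.inner p.1))
    rw [this, mul_zero, zero_add]
    rfl
  refine ⟨?_, fun v hv => ?_⟩
  · rw [h0, fibreLift_eq]
    exact hN1 p.2
  · rw [h0, mem_leafDistribution.1 hv]
    exact map_zero _

theorem metric_ext {E : Type*} [NormedAddCommGroup E] [NormedSpace ℝ E]
    {H : Type*} [TopologicalSpace H] {I : ModelWithCorners ℝ E H}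
    {M : Type*} [TopologicalSpace M] [ChartedSpace H M] [IsManifold I ∞ M] {g h : Metric I M}
    (hgh : ∀ p v w, g.inner p v w = h.inner p v w) : g = h := by
  have : g.inner = h.inner := funext fun p =>
    ContinuousLinearMap.ext fun v => ContinuousLinearMap.ext fun w => hgh p v w
  cases g
  cases h
  cases this
  rfl

/-- An adapted metric is determined by its restrictions to the leaves. -/
theorem eq_of_leafForm_eq (hN1 : ∀ y, g₂.inner y (N y) (N y) = 1)
    {h : Metric ((𝓡 n).prod (𝓡 1)) (M₁ × Circle)}
    (hg : IsAdapted leafDistribution (fibreLift N) g)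
    (hh : IsAdapted leafDistribution (fibreLift N) h)
    (hgh : ∀ p v w, leafForm g p v w = leafForm h p v w) : g = h := by
  refine metric_ext fun p v w => ?_
  have key : ∀ {k : Metric ((𝓡 n).prod (𝓡 1)) (M₁ × Circle)},
      IsAdapted leafDistribution (fibreLift N) k → ∀ {d : ℝ}, w.2 = d • N p.2 → ∀ {c : ℝ},
      v.2 = c • N p.2 → k.inner p v w = leafForm k p v.1 w.1 + d * c := by
    intro k hk d hd c hc
    have h1 : k.inner p v (leafVector p w.1) = leafForm k p v.1 w.1 := by
      have h2 := inner_leaf_fibreLift hk (p := p) (v := leafVector p w.1) rfl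
      rw [k.symm] at h2
      calc k.inner p v (leafVector p w.1)
          = k.inner p (leafVector p v.1 + c • fibreLift N p) (leafVector p w.1) := by
            rw [← eq_leaf_add_smul_fibreLift hc]
        _ = _ := by
            rw [map_add, map_smul, add_apply, smul_apply, h2, smul_zero, add_zero, leafForm_apply]
    have h2 := inner_fibreLift hk hc
    calc k.inner p v w = k.inner p v (leafVector p w.1 + d • fibreLift N p) := by
          rw [← eq_leaf_add_smul_fibreLift hd]
      _ = _ := by rw [map_add, map_smul, h1, h2, smul_eq_mul]
  obtain ⟨c, hc⟩ := exists_eq_smul hN1 p.2 v.2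
  obtain ⟨d, hd⟩ := exists_eq_smul hN1 p.2 w.2
  rw [key hg hd hc, key hh hd hc, hgh]

end ScaledMetric

/-! ### The flow as a heat equation: construction of solutions and comparison of two of them. -/

section Flow

variable {n : ℕ} {M₁ : Type*} [TopologicalSpace M₁] [ChartedSpace (EuclideanSpace ℝ (Fin n)) M₁]
  [IsManifold (𝓡 n) ∞ M₁] {g₁ : Metric (𝓡 n) M₁} {g₂ : Metric (𝓡 1) Circle}
  {N : VField (𝓡 1) Circle} {γ : ℝ → Circle} {ℓ : ℝ}

theorem deriv_deriv_bilinear_apply {E : Type*} [NormedAddCommGroup E] [NormedSpace ℝ E]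
    {B : ℝ → E →L[ℝ] E →L[ℝ] ℝ} (hB : ContDiff ℝ ∞ B) (v w : E) (s : ℝ) :
    deriv (deriv (fun s => B s v w)) s = deriv (deriv B) s v w := by
  have key : ∀ {B : ℝ → E →L[ℝ] E →L[ℝ] ℝ} {s : ℝ}, DifferentiableAt ℝ B s →
      deriv (fun s => B s v w) s = deriv B s v w := fun {B s} hB => by
    have h := (hasDerivAt_bilinear hB (differentiableAt_const v) (differentiableAt_const w)).deriv
    simpa using h
  have h1 : deriv (fun s => B s v w) = fun s => deriv B s v w := funext fun s =>
    key (hB.differentiable (by simp) s)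
  rw [h1]
  exact key ((contDiff_infty_iff_deriv.1 hB).2.differentiable (by simp) s)

/-- With the vectors frozen at the parameter `s`, the right-hand side of the flow is the second
derivative of a scalar function of `r`. -/
theorem lieDeriv_secondForm_eq_deriv [T2Space M₁] (hγ : IsUnitParam g₂ N γ ℓ)
    (hN : IsSmoothField (𝓡 1) N) (hN1 : ∀ y, g₂.inner y (N y) (N y) = 1)
    {g : Metric ((𝓡 n).prod (𝓡 1)) (M₁ × Circle)}
    (hg : IsAdapted leafDistribution (fibreLift N) g)
    {X Y : VField ((𝓡 n).prod (𝓡 1)) (M₁ × Circle)}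
    (hX : IsSmoothField ((𝓡 n).prod (𝓡 1)) X) (hY : IsSmoothField ((𝓡 n).prod (𝓡 1)) Y)
    (x : M₁) (s : ℝ) :
    -2 * lieDeriv (fibreLift N) (secondForm g (fibreLift N)) X Y (x, γ s) =
      deriv (deriv (fun r => leafForm g (x, γ r) (X (x, γ s)).1 (Y (x, γ s)).1)) s := by
  rw [lieDeriv_secondForm_eq hγ hN hN1 hg hX hY]
  exact (deriv_deriv_bilinear_apply (contDiff_leafForm hγ g x) _ _ s).symm

theorem IsFlowSolution.contMDiffOn_app {E : Type*} [NormedAddCommGroup E] [NormedSpace ℝ E]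
    {H : Type*} [TopologicalSpace H] {I : ModelWithCorners ℝ E H}
    {M : Type*} [TopologicalSpace M] [ChartedSpace H M] [IsManifold I ∞ M]
    {D : ∀ p : M, Submodule ℝ (TangentSpace I p)} {N : VField I M} {J : Set ℝ} {g : ℝ → Metric I M}
    (hg : IsFlowSolution D N J g) {X Y : VField I M} (hX : IsSmoothField I X)
    (hY : IsSmoothField I Y) :
    ContMDiffOn (𝓘(ℝ, ℝ).prod I) 𝓘(ℝ, ℝ) ∞ (fun q : ℝ × M => (g q.1).app X Y q.2) (J ×ˢ univ) :=
  fun q hq => contMDiffWithinAt_bilinear_apply (b := fun q : ℝ × M => q.2)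
    (φ := fun q => (g q.1).inner q.2) (hg.smooth q hq)
    (ContMDiff.comp hX contMDiff_snd).contMDiffAt.contMDiffWithinAt
    (ContMDiff.comp hY contMDiff_snd).contMDiffAt.contMDiffWithinAt

/-- On the leaves, a solution of the flow solves the heat equation along the fibres. -/
theorem IsFlowSolution.hasDerivWithinAt_leafForm [T2Space M₁] (hγ : IsUnitParam g₂ N γ ℓ)
    (hN : IsSmoothField (𝓡 1) N) (hN1 : ∀ y, g₂.inner y (N y) (N y) = 1) {J : Set ℝ}
    {h : ℝ → Metric ((𝓡 n).prod (𝓡 1)) (M₁ × Circle)}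
    (hh : IsFlowSolution leafDistribution (fibreLift N) J h) {t : ℝ} (ht : t ∈ J) (x : M₁) (s : ℝ)
    (v w : EuclideanSpace ℝ (Fin n)) :
    HasDerivWithinAt (fun t => leafForm (h t) (x, γ s) v w)
      (deriv (deriv (fun s => leafForm (h t) (x, γ s) v w)) s) J t := by
  obtain ⟨V, hV, rfl⟩ := exists_isSmoothField_eq (I := 𝓡 n) x v
  obtain ⟨W, hW, rfl⟩ := exists_isSmoothField_eq (I := 𝓡 n) x w
  have hV' := isSmoothField_prodField hV (isSmoothField_zero (I := 𝓡 1) (M := Circle))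
  have hW' := isSmoothField_prodField hW (isSmoothField_zero (I := 𝓡 1) (M := Circle))
  refine (hh.flow t ht _ _ hV' hW' (x, γ s)).congr_deriv ?_
  exact lieDeriv_secondForm_eq_deriv hγ hN hN1 (hh.adapted t ht) hV' hW' x s

/-- For fixed `x`, `v`, `w` both coefficients are periodic solutions of one scalar heat equation on
`[0, T]` with equal initial values. -/
theorem IsFlowSolution.leafForm_eq [T2Space M₁] (hγ : IsUnitParam g₂ N γ ℓ)
    (hN : IsSmoothField (𝓡 1) N) (hN1 : ∀ y, g₂.inner y (N y) (N y) = 1) {J J' : Set ℝ}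
    {h k : ℝ → Metric ((𝓡 n).prod (𝓡 1)) (M₁ × Circle)}
    (hh : IsFlowSolution leafDistribution (fibreLift N) J h)
    (hk : IsFlowSolution leafDistribution (fibreLift N) J' k) {T : ℝ} (hT : 0 ≤ T)
    (hJ : Icc 0 T ⊆ J) (hJ' : Icc 0 T ⊆ J')
    (h0 : ∀ p v w, leafForm (h 0) p v w = leafForm (k 0) p v w)
    (p : M₁ × Circle) (v w : EuclideanSpace ℝ (Fin n)) :
    leafForm (h T) p v w = leafForm (k T) p v w := by
  obtain ⟨x, y⟩ := p
  obtain ⟨s, rfl⟩ := hγ.surjective y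
  obtain ⟨V, hV, rfl⟩ := exists_isSmoothField_eq (I := 𝓡 n) x v
  obtain ⟨W, hW, rfl⟩ := exists_isSmoothField_eq (I := 𝓡 n) x w
  have hV' := isSmoothField_prodField hV (isSmoothField_zero (I := 𝓡 1) (M := Circle))
  have hW' := isSmoothField_prodField hW (isSmoothField_zero (I := 𝓡 1) (M := Circle))
  have hcont : ∀ {J : Set ℝ} {h : ℝ → Metric ((𝓡 n).prod (𝓡 1)) (M₁ × Circle)},
      IsFlowSolution leafDistribution (fibreLift N) J h → Icc 0 T ⊆ J →
      ContinuousOn (fun q : ℝ × ℝ => leafForm (h q.1) (x, γ q.2) (V x) (W x))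
        (Icc 0 T ×ˢ univ) := by
    intro J h hh hJ
    exact (hh.contMDiffOn_app hV' hW').continuousOn.comp
      (f := fun q : ℝ × ℝ => (q.1, (x, γ q.2)))
      (continuous_fst.prodMk (continuous_const.prodMk
        (hγ.smooth.continuous.comp continuous_snd))).continuousOn
      (fun q hq => ⟨hJ hq.1, mem_univ _⟩)
  have hsmooth : ∀ (h : Metric ((𝓡 n).prod (𝓡 1)) (M₁ × Circle)),
      ContDiff ℝ ∞ (fun s => leafForm h (x, γ s) (V x) (W x)) := fun h =>
    contDiff_clm_apply_iff.1 (contDiff_clm_apply_iff.1 (contDiff_leafForm hγ h x) (V x)) (W x)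
  have hper : ∀ (h : Metric ((𝓡 n).prod (𝓡 1)) (M₁ × Circle)),
      Function.Periodic (fun s => leafForm h (x, γ s) (V x) (W x)) ℓ := fun h s => by
    simp only [hγ.periodic s]
  have := heat_unique (T := T) (u := fun t s => leafForm (h t) (x, γ s) (V x) (W x))
    (v := fun t s => leafForm (k t) (x, γ s) (V x) (W x)) hγ.pos (hcont hh hJ) (hcont hk hJ')
    (fun t _ => hsmooth _) (fun t _ => hsmooth _) (fun t _ => hper _) (fun t _ => hper _)
    (funext fun s => h0 _ _ _)
    (fun t ht s => (hh.hasDerivWithinAt_leafForm hγ hN hN1 (hJ ht) x s _ _).mono hJ)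
    (fun t ht s => (hk.hasDerivWithinAt_leafForm hγ hN hN1 (hJ' ht) x s _ _).mono hJ')
    T ⟨hT, le_rfl⟩
  exact congrFun this s

theorem contMDiff_sqrt {E : Type*} [NormedAddCommGroup E] [NormedSpace ℝ E]
    {H : Type*} [TopologicalSpace H] {I : ModelWithCorners ℝ E H}
    {M : Type*} [TopologicalSpace M] [ChartedSpace H M] {c : M → ℝ} (hc : ContMDiff I 𝓘(ℝ, ℝ) ∞ c)
    (hpos : ∀ p, 0 < c p) : ContMDiff I 𝓘(ℝ, ℝ) ∞ (fun p => √(c p)) := fun p =>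
  (Real.contDiffAt_sqrt (hpos p).ne').contMDiffAt.comp p (hc p)

/-- The metrics `(c_t g₁) ⊕ g₂`, with `c_t` a solution of the heat equation along the fibres, solve
the extrinsic geometric flow. -/
theorem isFlowSolution_of_fibreHeat [T2Space M₁] (hγ : IsUnitParam g₂ N γ ℓ)
    (hN : IsSmoothField (𝓡 1) N) (hN1 : ∀ y, g₂.inner y (N y) (N y) = 1) {F : M₁ × Circle → ℝ}
    (hF : ContMDiff ((𝓡 n).prod (𝓡 1)) 𝓘(ℝ, ℝ) ∞ F)
    {g : ℝ → Metric ((𝓡 n).prod (𝓡 1)) (M₁ × Circle)}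
    (hg : ∀ t p, (g t).inner p = scaledForm g₁ g₂ (fibreHeat γ F t p) p) :
    IsFlowSolution leafDistribution (fibreLift N) (Ici 0) g := by
  have hsum : ∀ t, IsScaledSum g₁ g₂ (fibreHeat γ F t) (g t) := fun t p v w => by
    rw [mfderiv_fst_apply, mfderiv_fst_apply, mfderiv_snd_apply, mfderiv_snd_apply, hg]
    rfl
  refine ⟨fun t _ => (hsum t).isAdapted hN1, fun q hq => ?_, fun t ht X Y hX hY p => ?_⟩
  · simp only [hg]
    exact contMDiffWithinAt_scaledForm g₁ g₂ contMDiffWithinAt_snd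
      (contMDiffOn_fibreHeat hγ hF q hq)
  · obtain ⟨x, y⟩ := p
    obtain ⟨s, rfl⟩ := hγ.surjective y
    rw [lieDeriv_secondForm_eq_deriv hγ hN hN1 ((hsum t).isAdapted hN1) hX hY]
    simp only [(hsum t).leafForm_eq]
    have h1 : (fun r => (g r).app X Y (x, γ s)) = fun r => fibreHeat γ F r (x, γ s) *
        g₁.inner x (X (x, γ s)).1 (Y (x, γ s)).1 +
        -- Only the coefficient of `g₁` depends on time, so the flow reduces to the heat equation
        -- for `fibreHeat`.
        g₂.inner (γ s) (X (x, γ s)).2 (Y (x, γ s)).2 := funext fun r =>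
      (hsum r).inner_eq (x, γ s) (X (x, γ s)) (Y (x, γ s))
    have h2 : ∀ (φ : ℝ → ℝ) (a : ℝ), deriv (deriv fun r => φ r * a) s = deriv (deriv φ) s * a :=
      fun φ a => by
        rw [show (deriv fun r => φ r * a) = fun r => deriv φ r * a from
          funext fun r => deriv_mul_const_field a, deriv_mul_const_field]
    rw [h1]
    exact (((hasDerivWithinAt_fibreHeat hγ hF x s t).mul_const _).add_const _).congr_deriv
      (h2 _ _).symm

end Flow

end ExtrinsicFlow

end

/-! ### The main theorem. -/

open ExtrinsicFlow in
theorem proposition1 {n : ℕ} {M₁ : Type*} [TopologicalSpace M₁]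
    [ChartedSpace (EuclideanSpace ℝ (Fin n)) M₁] [IsManifold (𝓡 n) ∞ M₁]
    [CompactSpace M₁] [T2Space M₁]
    (g₁ : Metric (𝓡 n) M₁) (g₂ : Metric (𝓡 1) Circle)
    (N : VField (𝓡 1) Circle) (hN : IsSmoothField (𝓡 1) N)
    (hN_unit : ∀ y, g₂.inner y (N y) (N y) = 1)
    (f : M₁ × Circle → ℝ) (hf : ContMDiff ((𝓡 n).prod (𝓡 1)) 𝓘(ℝ, ℝ) ∞ f)
    (hf_pos : ∀ p, 0 < f p) :
    ∃ g : ℝ → Metric ((𝓡 n).prod (𝓡 1)) (M₁ × Circle),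
      -- a global smooth solution starting at the given twisted product
      IsFlowSolution leafDistribution (fibreLift N) (Ici 0) g ∧
      IsTwistedProduct g₁ g₂ f (g 0) ∧
      -- uniqueness, on `[0, ∞)` and on every smaller time interval containing `0`
      (∀ J : Set ℝ, J ⊆ Ici 0 → 0 ∈ J → J.OrdConnected →
        ∀ h : ℝ → Metric ((𝓡 n).prod (𝓡 1)) (M₁ × Circle),
          IsFlowSolution leafDistribution (fibreLift N) J h →
          IsTwistedProduct g₁ g₂ f (h 0) → ∀ t ∈ J, h t = g t) ∧
      -- the solution consists of twisted product metrics
      (∀ t : ℝ, 0 ≤ t → ∃ φ : M₁ × Circle → ℝ,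
        ContMDiff ((𝓡 n).prod (𝓡 1)) 𝓘(ℝ, ℝ) ∞ φ ∧ (∀ p, 0 < φ p) ∧
          IsTwistedProduct g₁ g₂ φ (g t)) ∧
      -- convergence to a product metric
      ∃ (h₁ : Metric (𝓡 n) M₁) (gInf : Metric ((𝓡 n).prod (𝓡 1)) (M₁ × Circle)),
        (∀ (x : M₁) (v w : TangentSpace (𝓡 n) x),
          h₁.inner x v w = circleMean g₂ (fun y => f (x, y) ^ 2) * g₁.inner x v w) ∧
        IsProductMetric h₁ g₂ gInf ∧
        ConvergesC0 g gInf := by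
  obtain ⟨γ, ℓ, hγ⟩ := exists_isUnitParam g₂ hN hN_unit
  set F : M₁ × Circle → ℝ := fun p => f p ^ 2
  have hF : ContMDiff ((𝓡 n).prod (𝓡 1)) 𝓘(ℝ, ℝ) ∞ F := by
    rw [show F = f * f from funext fun p => pow_two (f p)]
    exact hf.mul hf
  obtain ⟨m, B, hm, hmB⟩ := exists_bounds hF fun p => pow_pos (hf_pos p) 2
  have hc := contMDiff_fibreHeat hγ hF
  have hcpos : ∀ t p, 0 < fibreHeat γ F t p := fun t p => hm.trans_le
    (le_fibreHeat hγ hF.continuous (fun p => (hmB p).1) (fun p => (hmB p).2) t p)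
  have hmean := contMDiff_fibreMean hγ hF
  have hmean_le : ∀ x, m ≤ circleMean g₂ (fun y => F (x, y)) :=
    le_circleMean hγ hF.continuous fun p => (hmB p).1
  have hmean_pos : ∀ x, 0 < circleMean g₂ (fun y => F (x, y)) := fun x => hm.trans_le (hmean_le x)
  let g : ℝ → Metric ((𝓡 n).prod (𝓡 1)) (M₁ × Circle) := fun t =>
    scaledMetric g₁ g₂ (fibreHeat γ F t) (hc t) (hcpos t)
  have hg : IsFlowSolution leafDistribution (fibreLift N) (Ici 0) g :=
    isFlowSolution_of_fibreHeat hγ hN hN_unit hF fun t p => rfl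
  have hsum : ∀ t, IsScaledSum g₁ g₂ (fibreHeat γ F t) (g t) := fun t =>
    isScaledSum_scaledMetric (hc t) (hcpos t)
  have hg0 : IsTwistedProduct g₁ g₂ f (g 0) := by
    have := hsum 0
    rwa [fibreHeat_of_nonpos hγ le_rfl] at this
  let h₁ : Metric (𝓡 n) M₁ := conformalMetric g₁ _ hmean hmean_pos
  let gInf : Metric ((𝓡 n).prod (𝓡 1)) (M₁ × Circle) :=
    scaledMetric h₁ g₂ (fun _ => 1) contMDiff_const fun _ => one_pos
  refine ⟨g, hg, hg0, fun J hJ h0 hJc h hh hh0 t ht => ?_, fun t _ => ?_, h₁, gInf,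
    fun x v w => rfl, isScaledSum_scaledMetric _ _, ?_⟩
  · refine eq_of_leafForm_eq hN_unit (hh.adapted t ht) (hg.adapted t (hJ ht)) ?_
    -- Order-connectedness of `J` puts all of `[0, t]` inside it, where the two solutions are
    -- compared.
    refine hh.leafForm_eq hγ hN hN_unit hg (hJ ht) (hJc.out h0 ht) (fun s hs => hs.1)
      fun p v w => ?_
    rw [IsScaledSum.leafForm_eq hh0, IsScaledSum.leafForm_eq hg0]
  · refine ⟨fun p => √(fibreHeat γ F t p), contMDiff_sqrt (hc t) (hcpos t),
      fun p => Real.sqrt_pos.2 (hcpos t p), ?_⟩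
    have h1 : (fun p => √(fibreHeat γ F t p) ^ 2) = fibreHeat γ F t :=
      funext fun p => Real.sq_sqrt (hcpos t p).le
    rw [IsTwistedProduct, h1]
    exact hsum t
  · intro ε hε
    have hlim : Tendsto (fun t : ℝ => 2 * B * ℓ * (∫ z, |z| ∂(ProbabilityTheory.gaussianReal 0 1)) /
        √(2 * t)) atTop (𝓝 0) :=
      tendsto_const_nhds.div_atTop
        (Real.tendsto_sqrt_atTop.comp (tendsto_id.const_mul_atTop two_pos))
    -- The threshold is `ε * m` because the error is measured relative to the limit metric, whose
    -- coefficient, the mean of `f ^ 2`, is at least `m`. The `g₂` parts cancel in the difference.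
    filter_upwards [hlim.eventually (gt_mem_nhds (mul_pos hε hm)), eventually_gt_atTop 0]
      with t ht ht0 p v
    have h1 := abs_fibreHeat_sub_circleMean_le hγ hF.continuous
      (fun p => abs_le.2 ⟨by linarith [hmB p], (hmB p).2⟩) ht0 p
    have h2 := g₁.inner_self_nonneg p.1 v.1
    have h3 := g₂.inner_self_nonneg p.2 v.2
    have h4 : gInf.inner p v v = circleMean g₂ (fun y => F (p.1, y)) * g₁.inner p.1 v.1 v.1 +
        g₂.inner p.2 v.2 v.2 :=
      (IsScaledSum.inner_eq (isScaledSum_scaledMetric _ _) p v v).trans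
        (congrArg (· + _) (one_mul _))
    rw [(hsum t).inner_eq, h4, add_sub_add_right_eq_sub, ← sub_mul, abs_mul, abs_of_nonneg h2]
    have h5 : |fibreHeat γ F t p - circleMean g₂ (fun y => F (p.1, y))| ≤
        ε * circleMean g₂ (fun y => F (p.1, y)) :=
      (h1.trans ht.le).trans (mul_le_mul_of_nonneg_left (hmean_le p.1) hε.le)
    calc _ ≤ ε * circleMean g₂ (fun y => F (p.1, y)) * g₁.inner p.1 v.1 v.1 :=
          mul_le_mul_of_nonneg_right h5 h2
      _ ≤ _ := by rw [mul_add, mul_assoc]; linarith [mul_nonneg hε.le h3]
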